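/- **Setting.** Fix constants $0<D_L\le D_U<\infty$, a true parameter $\psi_*=(\beta_*,A_*)\in\mathbb R^p\times(0,\infty)$ with $A_*+D_L>(2\pi)^{-1}e^{-3}$, and $\alpha\in(0,1)$. Write $\phi(y;\mu,\sigma^2)$ for the $N(\mu,\sigma^2)$ density. *Model.* Let $(x,D)$ have a law $\nu$ such that almost surely $x\in\mathcal X$ and $D\in[D_L,D_U]$, where $\mathcal X\subset\mathbb R^p$ is bounded, and such that $E[xx^\top]$ is positive definite. For each $m$ let $(x_i,D_i,\theta_i,y_i)$, $i=1,\dots,m$, be i.i.d. with $(x_i,D_i)\sim\nu$, $$\theta_i\mid x_i,D_i\ \sim\ (1-\omega)\,N(x_i^\top\beta_*,A_*)+\omega\,\delta ,\qquad y_i\mid \theta_i,x_i,D_i\ \sim\ N(\theta_i,D_i),$$ where the contamination ratio $\omega=\omega_m\in[0,1/2)$ and the contamination distribution $\delta=\delta_m$ (a probability measure on $\mathbb R$) may depend on $m$. Put $f_\delta(y)=\int\phi(y;\theta,D)\,\delta(d\theta)$ and $$\rho=\max_{k\in\{0,1,2\}}\ \sup_{D\in[D_L,D_U]}\ \sup_{x\in\mathcal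 X}\int f_\delta(y)\,\phi(y;x^\top\beta_*,A_*+D)^{\gamma}\,|y-x^\top\beta_*|^k\,dy .$$ *Interval.* For $\gamma\in(0,1)$ and $\psi=(\beta,A)$ let $$w_\gamma(y_i)=\phi(y_i;x_i^\top\beta,A+D_i)^\gamma\{2\pi(A+D_i)\}^{\gamma^2/(2(1+\gamma))},\qquad \mathcal D_\gamma(y_i;\psi)=\gamma^{-1}w_\gamma(y_i),$$ $$\tilde\theta_i^{(\gamma)}=y_i-w_\gamma(y_i)\tfrac{D_i}{A+D_i}(y_i-x_i^\top\beta),\qquad \tilde s_i^{2(\gamma)}=D_i+w_\gamma(y_i)\tfrac{D_i^2}{(A+D_i)^2}\{\gamma(y_i-x_i^\top\beta)^2-(A+D_i)\}.$$ Let $\Psi\subset\mathbb R^p\times(0,\infty)$ be compact and let $\Psi_m$ be sets with $\psi_*\in\Psi_m\subseteq\Psi$ (for example $\Psi_m=\Psi$). Let $\hat\psi^{(\gamma)}$ be a (measurable) maximizer of $\sum_{i=1}^m\mathcal D_\gamma(y_i;\psi)$ over $\psi\in\Psi_m$, let $\hat\theta_i^{(\gamma)},\hat s_i^{(\gamma)}$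 be $\tilde\theta_i^{(\gamma)}$ and $\sqrt{\tilde s_i^{2(\gamma)}}$ at $\psi=\hat\psi^{(\gamma)}$, and let $$\hat I^{(\gamma)}_{i,1-\alpha}=\bigl(\hat\theta_i^{(\gamma)}-z_{\alpha/2}\hat s_i^{(\gamma)},\ \hat\theta_i^{(\gamma)}+z_{\alpha/2}\hat s_i^{(\gamma)}\bigr),$$ where $z_{\alpha/2}$ is the upper $\alpha/2$-quantile of $N(0,1)$; the interval is empty when $\tilde s_i^{2(\gamma)}\le 0$ at $\hat\psi^{(\gamma)}$. **Theorem.** There is a constant $C>0$, depending only on $p,D_L,D_U,\beta_*,A_*,\alpha$, such that the following holds. Let $0<\underline\gamma<\overline\gamma<1$ and let $\gamma=\gamma_m\in[\underline\gamma,\overline\gamma]$ (for example, a fixed $\gamma$). Assume that $\int y^2f_{\delta_m}(y)\,dy<\infty$ for every $m$ and every $D\in[D_L,D_U]$, and that $\omega_m\rho=O(m^{-\zeta})$ as $m\to\infty$ for some $\zeta\in(0,1/2)$, where $\rho$ is computed with $\delta_m$ and $\gamma_m$. Then for all sufficiently large $m$ and all $i=1,\dots,m$, $$\Bigl|P\bigl(\theta_i\in\hat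 I^{(\gamma)}_{i,1-\alpha}\bigr)-(1-\alpha)\Bigr|\ \le\ C\bigl((\omega_m\rho)^{1/4}+\gamma_m\bigr).$$ -/

import Mathlib

open MeasureTheory ProbabilityTheory Set Filter Topology Asymptotics
open scoped NNReal ENNReal

noncomputable section

namespace RobustFH

/-- Covariate vectors `x` and regression coefficients `β`. -/
abbrev Cov (p : ℕ) := EuclideanSpace ℝ (Fin p)

/-- Parameters `ψ = (β, A)`. -/
abbrev Param (p : ℕ) := Cov p × ℝ

variable {p : ℕ}

/-- The linear predictor `xᵀ β`. -/
def lin (x β : Cov p) : ℝ := ∑ j, x j * β j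

/-- The density at `y` of the normal distribution with mean `μ` and variance `σ2`. -/
def phi (y μ σ2 : ℝ) : ℝ := gaussianPDFReal μ σ2.toNNReal y

/-! ### The model -/

/-- Huber contaminated conditional law of `θ` given `(x, D)`:
`(1 - ω) N(xᵀβ, A) + ω δ`. -/
def thetaKernel (β : Cov p) (A ω : ℝ) (δ : Measure ℝ) : Kernel (Cov p × ℝ) ℝ where
  toFun z := ENNReal.ofReal (1 - ω) • gaussianReal (lin z.1 β) A.toNNReal + ENNReal.ofReal ω • δ
  measurable' := by
    have h1 : Measurable fun z : Cov p × ℝ => gaussianReal (lin z.1 β) A.toNNReal := by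
      have h : Measurable fun z : Cov p × ℝ => (lin z.1 β, A.toNNReal) := by
        unfold lin
        fun_prop
      exact measurable_gaussianReal.comp h
    refine Measure.measurable_of_measurable_coe _ fun s hs => ?_
    have h2 := (Measure.measurable_coe hs).comp h1
    simp only [Measure.coe_add, Measure.coe_smul, Pi.add_apply, Pi.smul_apply, smul_eq_mul]
    exact (h2.const_mul _).add_const _

/-- Conditional law of `y` given `((x, D), θ)`: `N(θ, D)`. -/
def obsKernel (p : ℕ) : Kernel ((Cov p × ℝ) × ℝ) ℝ where
  toFun z := gaussianReal z.2 z.1.2.toNNReal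
  measurable' := by
    have h : Measurable fun z : (Cov p × ℝ) × ℝ => (z.2, z.1.2.toNNReal) := by fun_prop
    exact measurable_gaussianReal.comp h

/-- Joint law of `(((x, D), θ), y)` for one area, when `(x, D)` has law `ν`. -/
def areaLaw (ν : Measure (Cov p × ℝ)) (β : Cov p) (A ω : ℝ) (δ : Measure ℝ) :
    Measure (((Cov p × ℝ) × ℝ) × ℝ) :=
  (ν ⊗ₘ thetaKernel β A ω δ) ⊗ₘ obsKernel p

/-- `f_δ(y) = ∫ φ(y; θ, D) δ(dθ)`, the marginal density of `y` when `θ ∼ δ`. -/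
def margDens (δ : Measure ℝ) (D y : ℝ) : ℝ := ∫ θ, phi y θ D ∂δ

/-- The separability index
`ρ = max_{k ∈ {0,1,2}} sup_{D ∈ [DL, DU]} sup_{x ∈ 𝒳} ∫ f_δ(y) φ(y; xᵀβ, A + D)^γ |y - xᵀβ|^k dy`. -/
def rho (𝒳 : Set (Cov p)) (DL DU : ℝ) (β : Cov p) (A γ : ℝ) (δ : Measure ℝ) : ℝ :=
  ⨆ k : Fin 3, ⨆ D : Icc DL DU, ⨆ x : 𝒳,
    ∫ y, margDens δ D y * phi y (lin x.1 β) (A + D) ^ γ * |y - lin x.1 β| ^ (k : ℕ)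

/-- The second moment matrix `E[x xᵀ]`. -/
def secondMoment (ν : Measure (Cov p × ℝ)) : Matrix (Fin p) (Fin p) ℝ :=
  Matrix.of fun j k => ∫ z, z.1 j * z.1 k ∂ν

/-! ### The γ-divergence empirical Bayes interval -/

/-- `c_γ(A) = {2π(A + D)}^{γ² / (2(1+γ))}`. -/
def cGamma (γ A D : ℝ) : ℝ := (2 * Real.pi * (A + D)) ^ (γ ^ 2 / (2 * (1 + γ)))

/-- `w_γ(y) = φ(y; xᵀβ, A + D)^γ c_γ(A)`. -/
def wGamma (γ : ℝ) (ψ : Param p) (x : Cov p) (D y : ℝ) : ℝ :=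
  phi y (lin x ψ.1) (ψ.2 + D) ^ γ * cGamma γ ψ.2 D

/-- The generalized log-likelihood `𝒟_γ(y; ψ) = γ⁻¹ w_γ(y)` of one area. -/
def gammaLik (γ : ℝ) (ψ : Param p) (x : Cov p) (D y : ℝ) : ℝ := 1 / γ * wGamma γ ψ x D y

/-- `ψ` maximizes `∑ i, 𝒟_γ(y i; ψ)` over the search set `S`. -/
def IsGammaEstimate {m : ℕ} (γ : ℝ) (S : Set (Param p))
    (x : Fin m → Cov p) (D y : Fin m → ℝ) (ψ : Param p) : Prop :=
  ψ ∈ S ∧ ∀ ψ' ∈ S, ∑ i, gammaLik γ ψ' (x i) (D i) (y i) ≤ ∑ i, gammaLik γ ψ (x i) (D i) (y i)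

/-- Robust posterior mean. -/
def thetaTilde (γ : ℝ) (ψ : Param p) (x : Cov p) (D y : ℝ) : ℝ :=
  y - wGamma γ ψ x D y * (D / (ψ.2 + D)) * (y - lin x ψ.1)

/-- Robust posterior variance. -/
def sTildeSq (γ : ℝ) (ψ : Param p) (x : Cov p) (D y : ℝ) : ℝ :=
  D + wGamma γ ψ x D y * (D ^ 2 / (ψ.2 + D) ^ 2) * (γ * (y - lin x ψ.1) ^ 2 - (ψ.2 + D))

/-- Upper quantile `z_a` of the standard normal distribution: `P(Z > z_a) = a`
for `a ∈ (0, 1)`. -/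
def zUpper (a : ℝ) : ℝ := sInf {z : ℝ | gaussianReal 0 1 (Ioi z) ≤ ENNReal.ofReal a}

/-- The interval `(θ̃ - z_{α/2} s̃, θ̃ + z_{α/2} s̃)` at the parameter `ψ`. If `s̃² ≤ 0`, then
`√s̃² = 0` and the interval is empty. -/
def robustInterval (α γ : ℝ) (ψ : Param p) (x : Cov p) (D y : ℝ) : Set ℝ :=
  Ioo (thetaTilde γ ψ x D y - zUpper (α / 2) * √(sTildeSq γ ψ x D y))
    (thetaTilde γ ψ x D y + zUpper (α / 2) * √(sTildeSq γ ψ x D y))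

end RobustFH

end

/-!
If `ω = 0` and `γ = 0`, the interval at `ψ_* = (β_*, A_*)` is the Bayes credible interval, which
covers exactly; for clean data, tilting the weight from `1` to `w_γ` costs `O(γ)`. The contamination
costs a multiple of `ω ρ` plus an arbitrarily small error: an outlier far from the regression line
has almost no weight, so its interval is nearly `y ± z √D` and covers almost correctly whatever `δ`
is, while the contaminating mass close to the line is at most a multiple of `ρ`.

The estimator enters only through consistency. Replacing `ψ_*` by another `ψ` loses expected weight,
up to a multiple of `ω ρ`, because `log` is strictly concave (for `A`) and `E[xxᵀ]` is positive
definite (for `β`); equicontinuity, a finite net of `Ψ` and Hoeffding's inequality then make the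
maximizer leave a neighbourhood of `ψ_*` with exponentially small probability. Inside it the
interval lies between two slight perturbations of the one at `ψ_*`. As `γ` is bounded below, every
error other than the `O(γ)` is eventually smaller than `γ`, hence the bound `C γ`.
-/

noncomputable section

namespace RobustFH

variable {p : ℕ}

/-! ### Real analysis -/

lemma abs_sqrt_sub_sqrt_mul_add_le (a b : ℝ) : |√a - √b| * (√a + √b) ≤ |a - b| := by
  have h : (√a - √b) * (√a + √b) = max a 0 - max b 0 := by
    rw [← Real.sq_sqrt' (x := a), ← Real.sq_sqrt' (x := b)]
    ring
  calc |√a - √b| * (√a + √b) = |(√a - √b) * (√a + √b)| := by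
        rw [abs_mul, abs_of_nonneg (a := √a + √b) (by positivity)]
    _ = |max a 0 - max b 0| := by rw [h]
    _ ≤ |a - b| := abs_max_sub_max_le_abs a b 0

lemma abs_sqrt_sub_sqrt_le_div {a b : ℝ} (hb : 0 < b) : |√a - √b| ≤ |a - b| / √b := by
  rw [le_div_iff₀ (Real.sqrt_pos.2 hb)]
  refine le_trans ?_ (abs_sqrt_sub_sqrt_mul_add_le a b)
  gcongr
  exact le_add_of_nonneg_left (Real.sqrt_nonneg a)

lemma abs_sqrt_sub_sqrt_le_sqrt (a b : ℝ) : |√a - √b| ≤ √|a - b| := by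
  refine Real.le_sqrt_of_sq_le (le_trans ?_ (abs_sqrt_sub_sqrt_mul_add_le a b))
  rw [pow_two]
  gcongr
  exact abs_le.2 ⟨by linarith [Real.sqrt_nonneg a], by linarith [Real.sqrt_nonneg b]⟩

lemma abs_exp_sub_one_le_abs_mul_exp {a L : ℝ} (hL : 0 ≤ L) (ha : a ≤ L) :
    |Real.exp a - 1| ≤ |a| * Real.exp L := by
  have hexp : Real.exp a ≤ Real.exp L := Real.exp_le_exp.2 ha
  rw [abs_le]
  constructor
  · calc -(|a| * Real.exp L) ≤ -|a| := by
          nlinarith [Real.one_le_exp hL, abs_nonneg a]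
      _ ≤ a := neg_abs_le a
      _ ≤ Real.exp a - 1 := by linarith [Real.add_one_le_exp a]
  · calc Real.exp a - 1 = (1 - Real.exp (-a)) * Real.exp a := by
          rw [sub_mul, ← Real.exp_add, neg_add_cancel, Real.exp_zero, one_mul]
      _ ≤ |a| * Real.exp a := by
          gcongr
          linarith [Real.add_one_le_exp (-a), le_abs_self a]
      _ ≤ |a| * Real.exp L := by gcongr

section Decay

variable {X F : Type*} [SeminormedAddCommGroup F] {K : Set X}

lemma uniformContinuousOn_of_norm_le_tendsto_cocompact {Y : Type*} [UniformSpace Y]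
    [UniformSpace X] {f : Y × X → F} {h : Y → ℝ} (hK : IsCompact K)
    (hf : ContinuousOn f (univ ×ˢ K)) (hh : Tendsto h (cocompact Y) (𝓝 0))
    (hb : ∀ z ∈ univ ×ˢ K, ‖f z‖ ≤ h z.1) : UniformContinuousOn f (univ ×ˢ K) := by
  have : CompactSpace K := isCompact_iff_compactSpace.1 hK
  let ι : Y × K → Y × X := fun z => (z.1, z.2)
  have hfst : Tendsto (Prod.fst : Y × K → Y) (cocompact _) (cocompact _) :=
    (hasBasis_cocompact.tendsto_iff hasBasis_cocompact).2 fun C hC =>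
      ⟨C ×ˢ univ, hC.prod isCompact_univ, fun _ hz hzC => hz ⟨hzC, mem_univ _⟩⟩
  have hlim : Tendsto (f ∘ ι) (cocompact _) (𝓝 0) :=
    squeeze_zero_norm (fun z => hb _ ⟨mem_univ _, z.2.2⟩) (hh.comp hfst)
  have hcont : Continuous (f ∘ ι) :=
    hf.comp_continuous (by fun_prop) fun z => ⟨mem_univ _, z.2.2⟩
  have hmap : UniformContinuous fun z : ↥((univ : Set Y) ×ˢ K) => (z.1.1, (⟨z.1.2, z.2.2⟩ : K)) :=
    (uniformContinuous_fst.comp uniformContinuous_subtype_val).prodMk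
      ((uniformContinuous_snd.comp uniformContinuous_subtype_val).subtype_mk _)
  exact uniformContinuousOn_iff_restrict.2
    ((hcont.uniformContinuous_of_tendsto_cocompact hlim).comp hmap)

lemma exists_norm_le_of_lt_norm {E : Type*} [SeminormedAddCommGroup E] [ProperSpace E]
    {f : E × X → F} {h : E → ℝ} (hh : Tendsto h (cocompact E) (𝓝 0))
    (hb : ∀ z ∈ univ ×ˢ K, ‖f z‖ ≤ h z.1) {ε : ℝ} (hε : 0 < ε) :
    ∃ R, ∀ z ∈ univ ×ˢ K, R < ‖z.1‖ → ‖f z‖ ≤ ε := by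
  have hev := hh.eventually (eventually_le_nhds hε)
  rw [← Metric.cobounded_eq_cocompact] at hev
  obtain ⟨R, -, hR⟩ := (Metric.hasBasis_cobounded_compl_closedBall (0 : E)).eventually_iff.1 hev
  exact ⟨R, fun z hz hzR => (hb z hz).trans (hR (by simpa using hzR))⟩

lemma tendsto_one_add_sq_mul_exp_neg_mul_sq_cocompact {k : ℝ} (hk : 0 < k) (C : ℝ) :
    Tendsto (fun u : ℝ => C * (1 + u ^ 2) * Real.exp (-k * u ^ 2)) (cocompact ℝ) (𝓝 0) := by
  have h0 := tendsto_rpow_abs_mul_exp_neg_mul_sq_cocompact hk 0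
  have h2 := tendsto_rpow_abs_mul_exp_neg_mul_sq_cocompact hk 2
  have h := (h0.add h2).const_mul C
  rw [add_zero, mul_zero] at h
  refine h.congr fun u => ?_
  simp only [Real.rpow_zero, Real.rpow_two, sq_abs]
  ring

end Decay

section Measure

variable {Ω : Type*} [MeasurableSpace Ω] {μ : Measure Ω} [IsFiniteMeasure μ]

lemma abs_measureReal_sub_le_of_ae_le {S L U F : Set Ω} {a b : ℝ} (hLS : L ≤ᵐ[μ] (S ∪ F : Set Ω))
    (hSU : S ≤ᵐ[μ] (U ∪ F : Set Ω)) (hL : a - b ≤ μ.real L) (hU : μ.real U ≤ a + b) :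
    |μ.real S - a| ≤ b + μ.real F := by
  have hmono : ∀ {A B : Set Ω}, A ≤ᵐ[μ] (B ∪ F : Set Ω) → μ.real A ≤ μ.real B + μ.real F :=
    fun h => (ENNReal.toReal_mono (measure_ne_top _ _) (measure_mono_ae h)).trans
      (measureReal_union_le _ _)
  rw [abs_le]
  constructor <;> linarith [hmono hLS, hmono hSU]

lemma abs_measureReal_sub_le {S T B : Set Ω} (h : ∀ x, x ∉ B → (x ∈ S ↔ x ∈ T)) :
    |μ.real S - μ.real T| ≤ μ.real B := by
  have hTS : T ⊆ S ∪ B := fun x hx => or_iff_not_imp_right.2 fun hB => (h x hB).2 hx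
  have hST : S ⊆ T ∪ B := fun x hx => or_iff_not_imp_right.2 fun hB => (h x hB).1 hx
  simpa only [zero_add] using abs_measureReal_sub_le_of_ae_le (a := μ.real T) (b := 0)
    hTS.eventuallyLE hST.eventuallyLE (sub_zero _).le (add_zero _).ge

end Measure

section Quantile

variable {μ : Measure ℝ} [IsProbabilityMeasure μ] [NullSingletonClass μ]

lemma continuous_cdf : Continuous (cdf μ) := by
  refine continuous_iff_continuousAt.2 fun z => ?_
  rw [(monotone_cdf μ).continuousAt_iff_leftLim_eq_rightLim, (cdf μ).rightLim_eq]
  have h : (cdf μ).measure {z} = 0 := by rw [measure_cdf, measure_singleton]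
  rw [StieltjesFunction.measure_singleton, ENNReal.ofReal_eq_zero] at h
  exact le_antisymm ((monotone_cdf μ).leftLim_le le_rfl) (by linarith)

omit [NullSingletonClass μ] in
lemma measureReal_Ioi_eq_one_sub_cdf (z : ℝ) : μ.real (Ioi z) = 1 - cdf μ z := by
  rw [cdf_eq_real, ← compl_Iic, probReal_compl_eq_one_sub measurableSet_Iic]

lemma measureReal_Ioi_sInf {a : ℝ} (ha : a ∈ Ioo (0 : ℝ) 1) :
    μ.real (Ioi (sInf {z | μ.real (Ioi z) ≤ a})) = a := by
  simp only [measureReal_Ioi_eq_one_sub_cdf]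
  set T := {z | 1 - cdf μ z ≤ a}
  obtain ⟨t, ht⟩ : T.Nonempty :=
    (((tendsto_cdf_atTop μ).const_sub 1).eventually (ge_mem_nhds (by linarith [ha.1]))).exists
  obtain ⟨b, hb⟩ : ∃ b, a < 1 - cdf μ b :=
    (((tendsto_cdf_atBot μ).const_sub 1).eventually (lt_mem_nhds (by linarith [ha.2]))).exists
  have hbdd : BddBelow T := ⟨b, fun z hz => by
    by_contra! hlt
    linarith [monotone_cdf μ hlt.le, mem_ofPred.1 hz]⟩
  have hcont : Continuous fun z => 1 - cdf μ z := continuous_const.sub continuous_cdf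
  have hmem : sInf T ∈ T := (isClosed_le hcont continuous_const).csInf_mem ⟨t, ht⟩ hbdd
  refine le_antisymm hmem ?_
  have hlim : Tendsto (fun z => 1 - cdf μ z) (𝓝[<] sInf T) (𝓝 (1 - cdf μ (sInf T))) :=
    hcont.continuousAt.tendsto.mono_left nhdsWithin_le_nhds
  refine ge_of_tendsto hlim (eventually_mem_nhdsWithin.mono fun z hz => ?_)
  exact (not_le.1 fun h => notMem_of_lt_csInf hz hbdd h).le

lemma measureReal_Ioo_neg_eq [μ.IsNegInvariant] {z : ℝ} (hz : μ.real (Ioi z) < 1 / 2) :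
    μ.real (Ioo (-z) z) = 1 - 2 * μ.real (Ioi z) := by
  have hsymm : cdf μ (-z) = 1 - cdf μ z := by
    rw [← measureReal_Ioi_eq_one_sub_cdf, cdf_eq_real, ← neg_Ici, measureReal_def,
      Measure.measure_neg, ← measureReal_def, measureReal_congr Ioi_ae_eq_Ici]
  rw [measureReal_Ioi_eq_one_sub_cdf] at hz ⊢
  have hz0 : -z ≤ z := by
    by_contra! hlt
    linarith [monotone_cdf μ hlt.le]
  rw [measureReal_congr Ioo_ae_eq_Ioc, ← Iic_sdiff_Iic,
    measureReal_sdiff (Iic_subset_Iic.2 hz0) measurableSet_Iic, ← cdf_eq_real, ← cdf_eq_real, hsymm]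
  ring

end Quantile

section Gaussian

lemma gaussianPDFReal_le_inv_sqrt {v : ℝ≥0} (c x : ℝ) :
    gaussianPDFReal c v x ≤ (√(2 * Real.pi * v))⁻¹ := by
  rw [gaussianPDFReal_def]
  refine mul_le_of_le_one_right (by positivity) (Real.exp_le_one_iff.2 ?_)
  exact div_nonpos_of_nonpos_of_nonneg (neg_nonpos.2 (sq_nonneg _)) (by positivity)

lemma gaussianReal_real_Icc_le {v : ℝ≥0} (hv : v ≠ 0) (c : ℝ) {a b : ℝ} (hab : a ≤ b) :
    (gaussianReal c v).real (Icc a b) ≤ (b - a) / √(2 * Real.pi * v) := by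
  have h := norm_setIntegral_le_of_norm_le_const (f := gaussianPDFReal c v) (μ := volume)
    (s := Icc a b) measure_Icc_lt_top fun x _ =>
      (Real.norm_of_nonneg (gaussianPDFReal_nonneg c v x)).trans_le
        (gaussianPDFReal_le_inv_sqrt c x)
  rw [measureReal_def, gaussianReal_apply_eq_integral c hv,
    ENNReal.toReal_ofReal (integral_nonneg (gaussianPDFReal_nonneg c v))]
  refine (le_abs_self _).trans (h.trans_eq ?_)
  rw [Real.volume_real_Icc_of_le hab, inv_mul_eq_div]

lemma gaussianReal_real_band_le {v : ℝ≥0} (hv : v ≠ 0) (c a h : ℝ) {r : ℝ} (hr : 0 ≤ r) :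
    (gaussianReal c v).real {t | |(|t - a| - h)| ≤ r} ≤ 4 * r / √(2 * Real.pi * v) := by
  have hsub : {t | |(|t - a| - h)| ≤ r} ⊆
      Icc (a - h - r) (a - h + r) ∪ Icc (a + h - r) (a + h + r) := by
    intro t ht
    rw [mem_ofPred, abs_le] at ht
    rcases abs_cases (t - a) with ⟨habs, -⟩ | ⟨habs, -⟩ <;> rw [habs] at ht
    · exact Or.inr ⟨by linarith, by linarith⟩
    · exact Or.inl ⟨by linarith, by linarith⟩
  calc (gaussianReal c v).real {t | |(|t - a| - h)| ≤ r}
      ≤ (gaussianReal c v).real (Icc (a - h - r) (a - h + r)) +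
          (gaussianReal c v).real (Icc (a + h - r) (a + h + r)) :=
        (measureReal_mono hsub).trans (measureReal_union_le _ _)
    _ ≤ (a - h + r - (a - h - r)) / √(2 * Real.pi * v) +
          (a + h + r - (a + h - r)) / √(2 * Real.pi * v) :=
        add_le_add (gaussianReal_real_Icc_le hv c (by linarith))
          (gaussianReal_real_Icc_le hv c (by linarith))
    _ = 4 * r / √(2 * Real.pi * v) := by ring

lemma abs_sub_lt_iff_of_notMem_band {t a h c h0 r : ℝ} (hr : |a - c| + |h - h0| ≤ r)
    (hB : ¬ |(|t - c| - h0)| ≤ r) : |t - a| < h ↔ |t - c| < h0 := by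
  have hcenter : |(|t - a| - |t - c|)| ≤ |a - c| := by
    simpa [abs_sub_comm a c] using abs_abs_sub_abs_le_abs_sub (t - a) (t - c)
  obtain ⟨hc1, hc2⟩ := abs_le.1 hcenter
  obtain ⟨hh1, hh2⟩ := abs_le.1 (le_refl |h - h0|)
  rw [not_le, lt_abs] at hB
  constructor <;> intro hlt <;> rcases hB with hB | hB <;> linarith

lemma abs_gaussianReal_real_interval_sub_le {v : ℝ≥0} (hv : v ≠ 0) (c' a h c h0 : ℝ) :
    |(gaussianReal c' v).real {t | |t - a| < h} - (gaussianReal c' v).real {t | |t - c| < h0}| ≤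
      4 * (|a - c| + |h - h0|) / √(2 * Real.pi * v) :=
  (abs_measureReal_sub_le fun _ ht => abs_sub_lt_iff_of_notMem_band le_rfl ht).trans
    (gaussianReal_real_band_le hv c' c h0 (by positivity))

lemma gaussianReal_eq_map_standard (c : ℝ) (v : ℝ≥0) :
    gaussianReal c v = (gaussianReal 0 1).map fun x => √v * x + c := by
  rw [show (fun x => √v * x + c) = (fun x => x + c) ∘ (fun x => √v * x) from rfl,
    ← Measure.map_map (by fun_prop) (by fun_prop), gaussianReal_map_const_mul,
    gaussianReal_map_add_const]
  congr 1
  · rw [mul_zero, zero_add]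
  · ext
    simp

instance : (gaussianReal 0 1).IsNegInvariant where
  neg_eq_self := by rw [Measure.neg, gaussianReal_map_neg, neg_zero]

lemma gaussianReal_real_Ioi_zUpper {a : ℝ} (ha : a ∈ Ioo (0 : ℝ) 1) :
    (gaussianReal 0 1).real (Ioi (zUpper a)) = a := by
  have := nullSingletonClass_gaussianReal (μ := 0) one_ne_zero
  have hset : {z | gaussianReal 0 1 (Ioi z) ≤ ENNReal.ofReal a} =
      {z | (gaussianReal 0 1).real (Ioi z) ≤ a} := by
    ext z
    exact ENNReal.le_ofReal_iff_toReal_le (measure_ne_top _ _) ha.1.le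
  rw [zUpper, hset, measureReal_Ioi_sInf ha]

lemma gaussianReal_real_interval {α : ℝ} (hα : α ∈ Ioo (0 : ℝ) 1) {v : ℝ≥0} (hv : v ≠ 0) (c : ℝ) :
    (gaussianReal c v).real {t | |t - c| < zUpper (α / 2) * √v} = 1 - α := by
  have := nullSingletonClass_gaussianReal (μ := 0) one_ne_zero
  have htail : (gaussianReal 0 1).real (Ioi (zUpper (α / 2))) = α / 2 :=
    gaussianReal_real_Ioi_zUpper ⟨half_pos hα.1, by linarith [hα.2]⟩
  have hstd : (gaussianReal 0 1).real (Ioo (-zUpper (α / 2)) (zUpper (α / 2))) = 1 - α := by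
    rw [measureReal_Ioo_neg_eq (by linarith [hα.2]), htail]
    ring
  rw [← hstd, gaussianReal_eq_map_standard c,
    map_measureReal_apply (by fun_prop) (measurableSet_lt (by fun_prop) (by fun_prop))]
  congr 1
  ext t
  have hsv : 0 < √(v : ℝ) := Real.sqrt_pos.2 (by positivity)
  rw [mem_preimage, mem_ofPred, add_sub_cancel_right, abs_mul, abs_of_pos hsv, mul_comm,
    mul_lt_mul_iff_left₀ hsv, mem_Ioo, abs_lt]

lemma abs_sqrt_mul_add_sub_pow (v : ℝ≥0) (c y : ℝ) (n : ℕ) :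
    |√v * y + c - c| ^ n = √v ^ n * |y| ^ n := by
  rw [add_sub_cancel_right, abs_mul, mul_pow, abs_of_nonneg (Real.sqrt_nonneg _)]

lemma integrable_abs_sub_pow_gaussianReal (c : ℝ) (v : ℝ≥0) (n : ℕ) :
    Integrable (fun y => |y - c| ^ n) (gaussianReal c v) := by
  have hstd : Integrable (fun y : ℝ => |y| ^ n) (gaussianReal 0 1) := by
    rcases eq_or_ne n 0 with rfl | hn
    · simp
    · simpa using (memLp_id_gaussianReal (μ := 0) (v := 1) n).integrable_norm_pow hn
  rw [gaussianReal_eq_map_standard, integrable_map_measure (by fun_prop) (by fun_prop)]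
  exact (hstd.const_mul (√v ^ n)).congr
    (.of_forall fun y => (abs_sqrt_mul_add_sub_pow v c y n).symm)

lemma integral_abs_sub_pow_gaussianReal (c : ℝ) (v : ℝ≥0) (n : ℕ) :
    ∫ y, |y - c| ^ n ∂(gaussianReal c v) = √v ^ n * ∫ y, |y| ^ n ∂(gaussianReal 0 1) := by
  rw [gaussianReal_eq_map_standard, integral_map (by fun_prop) (by fun_prop),
    ← integral_const_mul]
  simp only [abs_sqrt_mul_add_sub_pow]

lemma integral_abs_sub_pow_gaussianReal_le {s S : ℝ} (hs : 0 ≤ s) (hsS : s ≤ S) (c : ℝ) (n : ℕ) :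
    ∫ y, |y - c| ^ n ∂(gaussianReal c s.toNNReal) ≤ √S ^ n * ∫ y, |y| ^ n ∂(gaussianReal 0 1) := by
  rw [integral_abs_sub_pow_gaussianReal, Real.coe_toNNReal s hs]
  gcongr

/-! ### The normal-normal model -/

lemma gaussianPDFReal_mul_gaussianPDFReal {A D : ℝ} (hA : 0 < A) (hD : 0 < D) (μ θ y : ℝ) :
    gaussianPDFReal μ A.toNNReal θ * gaussianPDFReal θ D.toNNReal y =
      gaussianPDFReal μ (A + D).toNNReal y *
        gaussianPDFReal (y - D / (A + D) * (y - μ)) (A * D / (A + D)).toNNReal θ := by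
  have hs : 0 < A + D := by positivity
  have hv : 0 < A * D / (A + D) := by positivity
  simp only [gaussianPDFReal_def, Real.coe_toNNReal _ hA.le, Real.coe_toNNReal _ hD.le,
    Real.coe_toNNReal _ hs.le, Real.coe_toNNReal _ hv.le]
  have hnorm : (√(2 * Real.pi * A))⁻¹ * (√(2 * Real.pi * D))⁻¹ =
      (√(2 * Real.pi * (A + D)))⁻¹ * (√(2 * Real.pi * (A * D / (A + D))))⁻¹ := by
    rw [← mul_inv, ← mul_inv, ← Real.sqrt_mul (by positivity), ← Real.sqrt_mul (by positivity)]
    congr 2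
    field_simp
  rw [mul_mul_mul_comm, hnorm, mul_mul_mul_comm _ (Real.exp _), ← Real.exp_add, ← Real.exp_add]
  congr 2
  field_simp
  ring

lemma integral_gaussianPDFReal_mul_gaussianPDFReal {A D : ℝ} (hA : 0 < A) (hD : 0 < D) (μ y : ℝ) :
    ∫ θ, gaussianPDFReal μ A.toNNReal θ * gaussianPDFReal θ D.toNNReal y =
      gaussianPDFReal μ (A + D).toNNReal y := by
  have hv : (A * D / (A + D)).toNNReal ≠ 0 := (Real.toNNReal_pos.2 (by positivity)).ne'
  simp only [gaussianPDFReal_mul_gaussianPDFReal hA hD]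
  rw [integral_const_mul, integral_gaussianPDFReal_eq_one _ hv, mul_one]

lemma measurable_gaussianPDFReal_comp {X : Type*} [MeasurableSpace X] {f g : X → ℝ} {v : ℝ≥0}
    (hf : Measurable f) (hg : Measurable g) :
    Measurable fun x => gaussianPDFReal (f x) v (g x) := by
  unfold gaussianPDFReal
  fun_prop

lemma integrable_gaussianPDFReal_mul_gaussianPDFReal (μ : ℝ) (v : ℝ≥0) {w : ℝ≥0} (hw : w ≠ 0) :
    Integrable (fun z : ℝ × ℝ => gaussianPDFReal μ v z.1 * gaussianPDFReal z.1 w z.2)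
      (volume.prod volume) := by
  have hm : Measurable fun z : ℝ × ℝ => gaussianPDFReal μ v z.1 * gaussianPDFReal z.1 w z.2 :=
    (measurable_gaussianPDFReal_comp measurable_const measurable_fst).mul
      (measurable_gaussianPDFReal_comp measurable_fst measurable_snd)
  rw [integrable_prod_iff hm.aestronglyMeasurable]
  refine ⟨.of_forall fun θ =>
    (integrable_gaussianPDFReal θ w).const_mul (gaussianPDFReal μ v θ), ?_⟩
  refine (integrable_gaussianPDFReal μ v).congr (.of_forall fun θ => ?_)
  simp only [norm_mul, Real.norm_eq_abs, abs_of_nonneg (gaussianPDFReal_nonneg _ _ _)]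
  rw [integral_const_mul, integral_gaussianPDFReal_eq_one _ hw, mul_one]

lemma integral_integral_gaussianReal_swap {A D : ℝ} (hA : 0 < A) (hD : 0 < D) (μ : ℝ)
    {f : ℝ → ℝ → ℝ} (hf : Measurable (Function.uncurry f)) {B : ℝ} (hB : ∀ θ y, |f θ y| ≤ B) :
    ∫ θ, ∫ y, f θ y ∂(gaussianReal θ D.toNNReal) ∂(gaussianReal μ A.toNNReal) =
      ∫ y, ∫ θ, f θ y ∂(gaussianReal (y - D / (A + D) * (y - μ)) (A * D / (A + D)).toNNReal)
        ∂(gaussianReal μ (A + D).toNNReal) := by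
  have nz : ∀ {t : ℝ}, 0 < t → t.toNNReal ≠ 0 := fun h => (Real.toNNReal_pos.2 h).ne'
  simp only [integral_gaussianReal_eq_integral_smul (nz hA),
    integral_gaussianReal_eq_integral_smul (nz hD),
    integral_gaussianReal_eq_integral_smul (nz (add_pos hA hD)),
    integral_gaussianReal_eq_integral_smul (nz (div_pos (mul_pos hA hD) (add_pos hA hD))),
    smul_eq_mul, ← integral_const_mul, ← mul_assoc]
  simp only [← gaussianPDFReal_mul_gaussianPDFReal hA hD]
  exact integral_integral_swap
    ((integrable_gaussianPDFReal_mul_gaussianPDFReal μ A.toNNReal (nz hD)).mul_bdd (c := B)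
      hf.aestronglyMeasurable (.of_forall fun z => hB z.1 z.2))

end Gaussian

section Concentration

lemma measureReal_sum_ge_le_exp {Ω E : Type*} [MeasurableSpace Ω] [MeasurableSpace E]
    {P : Measure Ω} [IsProbabilityMeasure P] {Q : Measure E} {m : ℕ} {X : Fin m → Ω → E}
    (hind : iIndepFun X P) (hlaw : ∀ i, HasLaw (X i) Q P) {f : E → ℝ} (hf : Measurable f)
    {B r : ℝ} (hB : ∀ t, |f t| ≤ B) (hr : 0 ≤ r) (hmean : ∫ t, f t ∂Q ≤ -(2 * r)) :
    P.real {w | -(m * r) ≤ ∑ i, f (X i w)} ≤ Real.exp (-(m * (r ^ 2 / (2 * B ^ 2)))) := by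
  have hE : ∀ i, ∫ w, f (X i w) ∂P = ∫ t, f t ∂Q := fun i => by
    rw [← (hlaw i).map_eq, integral_map (hlaw i).aemeasurable hf.aestronglyMeasurable]
  have hsub : ∀ i ∈ (Finset.univ : Finset (Fin m)), HasSubgaussianMGF
      (fun w => f (X i w) - ∫ t, f t ∂Q) ((‖B - -B‖₊ / 2) ^ 2) P := fun i _ => by
    rw [← hE i]
    exact hasSubgaussianMGF_of_mem_Icc (hf.comp_aemeasurable (hlaw i).aemeasurable)
      (.of_forall fun w => abs_le.1 (hB _))
  have hind' : iIndepFun (fun i w => f (X i w) - ∫ t, f t ∂Q) P :=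
    hind.comp (fun _ t => f t - ∫ t, f t ∂Q) fun _ => hf.sub_const _
  have hoeffding := HasSubgaussianMGF.measure_sum_ge_le_of_iIndepFun hind' hsub
    (ε := m * r) (by positivity)
  refine (measureReal_mono fun w hw => ?_).trans (hoeffding.trans_eq ?_)
  · simp only [mem_ofPred_eq, Finset.sum_sub_distrib, Finset.sum_const, Finset.card_univ,
      Fintype.card_fin, nsmul_eq_mul] at hw ⊢
    have : (m : ℝ) * ∫ t, f t ∂Q ≤ m * -(2 * r) := by gcongr
    linarith
  · have hBB : ‖B - -B‖ / 2 = |B| := by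
      rw [sub_neg_eq_add, ← two_mul, norm_mul, Real.norm_two, Real.norm_eq_abs,
        mul_div_cancel_left₀ _ two_ne_zero]
    simp only [Finset.sum_const, Finset.card_univ, Fintype.card_fin, nsmul_eq_mul]
    push_cast
    rw [hBB, sq_abs]
    rcases eq_or_ne (m : ℝ) 0 with h0 | _
    · simp [h0]
    · field_simp

end Concentration

/-! ### The density power weight -/

/-- The weight `w_γ` as a function of the total variance `s = A + D` and the residual
`u = y - xᵀβ`; the power of `2πs` merges the normalizations of `φ^γ` and `c_γ`. -/
def weight (γ s u : ℝ) : ℝ :=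
  (2 * Real.pi * s) ^ (-(γ / (2 * (1 + γ)))) * Real.exp (-(γ * u ^ 2) / (2 * s))

/-- The shrinkage `y - θ̃` as a function of the total variance, the sampling variance and the
residual. -/
def shift (γ s D u : ℝ) : ℝ := weight γ s u * (D / s) * u

/-- The variance correction `s̃² - D` as a function of the total variance, the sampling variance
and the residual. -/
def varShift (γ s D u : ℝ) : ℝ := weight γ s u * (D ^ 2 / s ^ 2) * (γ * u ^ 2 - s)

lemma phi_eq {y μ s : ℝ} (hs : 0 < s) :
    phi y μ s = (2 * Real.pi * s) ^ (-(1 / 2) : ℝ) * Real.exp (-(y - μ) ^ 2 / (2 * s)) := by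
  have h : 0 < 2 * Real.pi * s := by positivity
  rw [phi, gaussianPDFReal_def, Real.coe_toNNReal _ hs.le, Real.rpow_neg h.le, Real.sqrt_eq_rpow]

lemma weight_pos {γ s u : ℝ} (hs : 0 < s) : 0 < weight γ s u := by
  unfold weight
  positivity

lemma weight_le_weight_zero {γ s u : ℝ} (hγ : 0 ≤ γ) (hs : 0 < s) :
    weight γ s u ≤ weight γ s 0 := by
  unfold weight
  gcongr _ * Real.exp ?_
  simpa using div_nonpos_of_nonpos_of_nonneg (neg_nonpos.2 (by positivity : 0 ≤ γ * u ^ 2))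
    (by positivity)

lemma integrable_weight_sub {γ s : ℝ} (hγ : 0 ≤ γ) (hs : 0 < s) (μ : ℝ) (τ : Measure ℝ)
    [IsFiniteMeasure τ] : Integrable (fun y => weight γ s (y - μ)) τ := by
  refine .of_bound ?_ (weight γ s 0) (.of_forall fun y => ?_)
  · unfold weight
    fun_prop
  · rw [Real.norm_eq_abs, abs_of_pos (weight_pos hs)]
    exact weight_le_weight_zero hγ hs

section Param

variable {γ : ℝ} {ψ : Param p} {x : Cov p} {D y : ℝ}

lemma wGamma_eq (hγ : 0 ≤ γ) (hs : 0 < ψ.2 + D) :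
    wGamma γ ψ x D y = weight γ (ψ.2 + D) (y - lin x ψ.1) := by
  have h : 0 < 2 * Real.pi * (ψ.2 + D) := by positivity
  rw [wGamma, cGamma, weight, phi_eq hs, Real.mul_rpow (by positivity) (by positivity),
    ← Real.rpow_mul h.le, ← Real.exp_mul, mul_right_comm, ← Real.rpow_add h]
  congr 2
  · field_simp
    ring
  · field_simp

lemma thetaTilde_eq (hγ : 0 ≤ γ) (hs : 0 < ψ.2 + D) :
    thetaTilde γ ψ x D y = y - shift γ (ψ.2 + D) D (y - lin x ψ.1) := by
  rw [thetaTilde, shift, wGamma_eq hγ hs]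

lemma sTildeSq_eq (hγ : 0 ≤ γ) (hs : 0 < ψ.2 + D) :
    sTildeSq γ ψ x D y = D + varShift γ (ψ.2 + D) D (y - lin x ψ.1) := by
  rw [sTildeSq, varShift, wGamma_eq hγ hs]

end Param

section Box

variable {DL DU s2 γlo γhi : ℝ}

/-- The set of triples `(s, γ, D)` of a total variance, a tuning parameter and a sampling variance
over which the estimates below are uniform. -/
def box (DL DU s2 γlo γhi : ℝ) : Set (ℝ × ℝ × ℝ) := Icc DL s2 ×ˢ Icc γlo γhi ×ˢ Icc DL DU

lemma isCompact_box : IsCompact (box DL DU s2 γlo γhi) :=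
  isCompact_Icc.prod (isCompact_Icc.prod isCompact_Icc)

lemma continuousOn_weight (hDL : 0 < DL) (hγ : 0 < γlo) :
    ContinuousOn (fun z : ℝ × ℝ × ℝ × ℝ => weight z.2.2.1 z.2.1 z.1)
      (univ ×ˢ box DL DU s2 γlo γhi) := by
  unfold weight
  have hs : ∀ z ∈ (univ : Set ℝ) ×ˢ box DL DU s2 γlo γhi, 0 < 2 * Real.pi * z.2.1 :=
    fun z hz => mul_pos Real.two_pi_pos (hDL.trans_le hz.2.1.1)
  have hg : ∀ z ∈ (univ : Set ℝ) ×ˢ box DL DU s2 γlo γhi, 2 * (1 + z.2.2.1) ≠ 0 :=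
    fun z hz => by linarith [hz.2.2.1.1]
  refine ContinuousOn.mul (ContinuousOn.rpow (by fun_prop) ?_ fun z hz => Or.inl (hs z hz).ne')
    (Real.continuous_exp.comp_continuousOn (ContinuousOn.div (by fun_prop) (by fun_prop) ?_))
  · exact (ContinuousOn.div (by fun_prop) (by fun_prop) hg).neg
  · exact fun z hz => mul_ne_zero two_ne_zero (hDL.trans_le hz.2.1.1).ne'

lemma exists_weight_le_mul_exp (hDL : 0 < DL) (hγ : 0 < γlo) :
    ∃ W > 0, ∀ z ∈ (univ : Set ℝ) ×ˢ box DL DU s2 γlo γhi,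
      |weight z.2.2.1 z.2.1 z.1| ≤ W * Real.exp (-(γlo / (2 * s2)) * z.1 ^ 2) := by
  have hcont : ContinuousOn (fun z : ℝ × ℝ × ℝ => weight z.2.1 z.1 0) (box DL DU s2 γlo γhi) :=
    (continuousOn_weight (DU := DU) (s2 := s2) (γhi := γhi) hDL hγ).comp
      (f := fun z => ((0 : ℝ), z)) (by fun_prop) fun z hz => ⟨mem_univ _, hz⟩
  obtain ⟨W, hW⟩ := isCompact_box.exists_bound_of_continuousOn hcont
  refine ⟨max W 1, by positivity, fun ⟨u, s, γ, D⟩ ⟨_, hz⟩ => ?_⟩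
  obtain ⟨⟨hs1, hs2⟩, ⟨hγ1, -⟩, -⟩ := id hz
  have hs : 0 < s := hDL.trans_le hs1
  have hγ0 : 0 < γ := hγ.trans_le hγ1
  have hrate : γlo / (2 * s2) ≤ γ / (2 * s) := by gcongr
  have hsplit : weight γ s u = weight γ s 0 * Real.exp (-(γ / (2 * s)) * u ^ 2) := by
    simp only [weight, ne_eq, OfNat.ofNat_ne_zero, not_false_eq_true, zero_pow, mul_zero, neg_zero,
      zero_div, Real.exp_zero, mul_one]
    ring_nf
  rw [hsplit, abs_mul, Real.abs_exp]
  gcongr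
  exact (hW (s, γ, D) hz).trans (le_max_left W 1)

section WeightMul

variable {q : ℝ × ℝ × ℝ × ℝ → ℝ} {Q : ℝ}

lemma exists_weight_mul_le (hDL : 0 < DL) (hγ : 0 < γlo)
    (hq : ∀ z ∈ (univ : Set ℝ) ×ˢ box DL DU s2 γlo γhi, |q z| ≤ Q * (1 + z.1 ^ 2)) :
    ∃ C, ∀ z ∈ (univ : Set ℝ) ×ˢ box DL DU s2 γlo γhi, ‖weight z.2.2.1 z.2.1 z.1 * q z‖ ≤
      C * (1 + z.1 ^ 2) * Real.exp (-(γlo / (2 * s2)) * z.1 ^ 2) := by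
  obtain ⟨W, hW0, hW⟩ := exists_weight_le_mul_exp (DU := DU) (s2 := s2) (γhi := γhi) hDL hγ
  refine ⟨W * Q, fun z hz => ?_⟩
  calc ‖weight z.2.2.1 z.2.1 z.1 * q z‖ = |weight z.2.2.1 z.2.1 z.1| * |q z| := abs_mul _ _
    _ ≤ W * Real.exp (-(γlo / (2 * s2)) * z.1 ^ 2) * (Q * (1 + z.1 ^ 2)) :=
        mul_le_mul (hW z hz) (hq z hz) (abs_nonneg _) (by positivity)
    _ = W * Q * (1 + z.1 ^ 2) * Real.exp (-(γlo / (2 * s2)) * z.1 ^ 2) := by ring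

lemma uniformContinuousOn_weight_mul (hDL : 0 < DL) (hs2 : 0 < s2) (hγ : 0 < γlo)
    (hcont : ContinuousOn q (univ ×ˢ box DL DU s2 γlo γhi))
    (hq : ∀ z ∈ (univ : Set ℝ) ×ˢ box DL DU s2 γlo γhi, |q z| ≤ Q * (1 + z.1 ^ 2)) :
    UniformContinuousOn (fun z => weight z.2.2.1 z.2.1 z.1 * q z)
      (univ ×ˢ box DL DU s2 γlo γhi) := by
  obtain ⟨C, hC⟩ := exists_weight_mul_le hDL hγ hq
  exact uniformContinuousOn_of_norm_le_tendsto_cocompact isCompact_box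
    ((continuousOn_weight hDL hγ).mul hcont)
    (tendsto_one_add_sq_mul_exp_neg_mul_sq_cocompact (by positivity) C) hC

lemma exists_abs_weight_mul_le_of_lt_abs (hDL : 0 < DL) (hs2 : 0 < s2) (hγ : 0 < γlo)
    (hq : ∀ z ∈ (univ : Set ℝ) ×ˢ box DL DU s2 γlo γhi, |q z| ≤ Q * (1 + z.1 ^ 2))
    {ε : ℝ} (hε : 0 < ε) :
    ∃ R, ∀ z ∈ (univ : Set ℝ) ×ˢ box DL DU s2 γlo γhi, R < |z.1| →
      |weight z.2.2.1 z.2.1 z.1 * q z| ≤ ε := by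
  obtain ⟨C, hC⟩ := exists_weight_mul_le hDL hγ hq
  exact exists_norm_le_of_lt_norm
    (tendsto_one_add_sq_mul_exp_neg_mul_sq_cocompact (by positivity) C) hC hε

end WeightMul

lemma abs_shift_factor_le (hDL : 0 < DL) {z : ℝ × ℝ × ℝ × ℝ}
    (hz : z ∈ (univ : Set ℝ) ×ˢ box DL DU s2 γlo γhi) :
    |z.2.2.2 / z.2.1 * z.1| ≤ DU / DL * (1 + z.1 ^ 2) := by
  obtain ⟨u, s, γ, D⟩ := z
  obtain ⟨-, ⟨hs1, -⟩, -, hD1, hD2⟩ := hz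
  dsimp only at hs1 hD1 hD2 ⊢
  have hD : 0 < D := hDL.trans_le hD1
  have hDU : 0 < DU := hD.trans_le hD2
  have hs : 0 < s := hDL.trans_le hs1
  have hu : |u| ≤ 1 + u ^ 2 := by nlinarith [sq_abs u, sq_nonneg (|u| - 1)]
  rw [abs_mul, abs_of_pos (div_pos hD hs)]
  gcongr

lemma abs_varShift_factor_le (hDL : 0 < DL) (hγ : 0 < γlo) {z : ℝ × ℝ × ℝ × ℝ}
    (hz : z ∈ (univ : Set ℝ) ×ˢ box DL DU s2 γlo γhi) :
    |z.2.2.2 ^ 2 / z.2.1 ^ 2 * (z.2.2.1 * z.1 ^ 2 - z.2.1)| ≤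
      DU ^ 2 / DL ^ 2 * (γhi + s2) * (1 + z.1 ^ 2) := by
  obtain ⟨u, s, γ, D⟩ := z
  obtain ⟨-, ⟨hs1, hs2⟩, ⟨hγ1, hγ2⟩, hD1, hD2⟩ := hz
  dsimp only at hs1 hs2 hγ1 hγ2 hD1 hD2 ⊢
  have hD : 0 < D := hDL.trans_le hD1
  have hs : 0 < s := hDL.trans_le hs1
  have hγ0 : 0 < γ := hγ.trans_le hγ1
  have hlin : |γ * u ^ 2 - s| ≤ (γhi + s2) * (1 + u ^ 2) := by
    rw [abs_le]
    constructor <;> nlinarith [sq_nonneg u, mul_nonneg hγ0.le (sq_nonneg u)]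
  rw [abs_mul, abs_of_pos (by positivity), mul_assoc (DU ^ 2 / DL ^ 2)]
  gcongr

lemma continuousOn_shift_factor (hDL : 0 < DL) :
    ContinuousOn (fun z : ℝ × ℝ × ℝ × ℝ => z.2.2.2 / z.2.1 * z.1)
      (univ ×ˢ box DL DU s2 γlo γhi) :=
  (ContinuousOn.div (by fun_prop) (by fun_prop) fun _ hz =>
    (hDL.trans_le hz.2.1.1).ne').mul (by fun_prop)

lemma continuousOn_varShift_factor (hDL : 0 < DL) :
    ContinuousOn (fun z : ℝ × ℝ × ℝ × ℝ => z.2.2.2 ^ 2 / z.2.1 ^ 2 * (z.2.2.1 * z.1 ^ 2 - z.2.1))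
      (univ ×ˢ box DL DU s2 γlo γhi) :=
  (ContinuousOn.div (by fun_prop) (by fun_prop) fun _ hz =>
    pow_ne_zero 2 (hDL.trans_le hz.2.1.1).ne').mul (by fun_prop)

lemma abs_one_le_one_mul_one_add_sq (u : ℝ) : |(1 : ℝ)| ≤ 1 * (1 + u ^ 2) := by
  rw [abs_one, one_mul]
  exact le_add_of_nonneg_right (sq_nonneg u)

lemma uniformContinuousOn_weight (hDL : 0 < DL) (hs2 : 0 < s2) (hγ : 0 < γlo) :
    UniformContinuousOn (fun z : ℝ × ℝ × ℝ × ℝ => weight z.2.2.1 z.2.1 z.1)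
      (univ ×ˢ box DL DU s2 γlo γhi) := by
  simpa only [mul_one] using uniformContinuousOn_weight_mul (q := fun _ => 1) (Q := 1) hDL hs2 hγ
    continuousOn_const fun _ _ => abs_one_le_one_mul_one_add_sq _

lemma uniformContinuousOn_shift (hDL : 0 < DL) (hs2 : 0 < s2) (hγ : 0 < γlo) :
    UniformContinuousOn (fun z : ℝ × ℝ × ℝ × ℝ => shift z.2.2.1 z.2.1 z.2.2.2 z.1)
      (univ ×ˢ box DL DU s2 γlo γhi) := by
  simpa only [shift, mul_assoc] using uniformContinuousOn_weight_mul hDL hs2 hγ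
    (continuousOn_shift_factor hDL) fun _ hz => abs_shift_factor_le hDL hz

lemma uniformContinuousOn_varShift (hDL : 0 < DL) (hs2 : 0 < s2) (hγ : 0 < γlo) :
    UniformContinuousOn (fun z : ℝ × ℝ × ℝ × ℝ => varShift z.2.2.1 z.2.1 z.2.2.2 z.1)
      (univ ×ˢ box DL DU s2 γlo γhi) := by
  simpa only [varShift, mul_assoc] using uniformContinuousOn_weight_mul hDL hs2 hγ
    (continuousOn_varShift_factor hDL) fun _ hz => abs_varShift_factor_le hDL hγ hz

lemma exists_weight_le_of_lt_abs (hDL : 0 < DL) (hs2 : 0 < s2) (hγ : 0 < γlo) {ε : ℝ}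
    (hε : 0 < ε) : ∃ R, ∀ u, ∀ z ∈ box DL DU s2 γlo γhi, R < |u| → weight z.2.1 z.1 u ≤ ε := by
  obtain ⟨R, hR⟩ := exists_abs_weight_mul_le_of_lt_abs (DU := DU) (γhi := γhi) (q := fun _ => 1)
    (Q := 1) hDL hs2 hγ (fun _ _ => abs_one_le_one_mul_one_add_sq _) hε
  exact ⟨R, fun u z hz hu => by
    simpa only [mul_one] using (le_abs_self _).trans (hR (u, z) ⟨mem_univ u, hz⟩ hu)⟩

lemma exists_abs_shift_le_of_lt_abs (hDL : 0 < DL) (hs2 : 0 < s2) (hγ : 0 < γlo) {ε : ℝ}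
    (hε : 0 < ε) : ∃ R, ∀ u, ∀ z ∈ box DL DU s2 γlo γhi, R < |u| →
      |shift z.2.1 z.1 z.2.2 u| ≤ ε := by
  obtain ⟨R, hR⟩ := exists_abs_weight_mul_le_of_lt_abs (γhi := γhi) hDL hs2 hγ
    (fun _ hz => abs_shift_factor_le (DU := DU) hDL hz) hε
  exact ⟨R, fun u z hz hu => by
    simpa only [shift, mul_assoc] using hR (u, z) ⟨mem_univ u, hz⟩ hu⟩

lemma exists_abs_varShift_le_of_lt_abs (hDL : 0 < DL) (hs2 : 0 < s2) (hγ : 0 < γlo) {ε : ℝ}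
    (hε : 0 < ε) : ∃ R, ∀ u, ∀ z ∈ box DL DU s2 γlo γhi, R < |u| →
      |varShift z.2.1 z.1 z.2.2 u| ≤ ε := by
  obtain ⟨R, hR⟩ := exists_abs_weight_mul_le_of_lt_abs (γhi := γhi) hDL hs2 hγ
    (fun _ hz => abs_varShift_factor_le (DU := DU) hDL hγ hz) hε
  exact ⟨R, fun u z hz hu => by
    simpa only [varShift, mul_assoc] using hR (u, z) ⟨mem_univ u, hz⟩ hu⟩

end Box

section FirstOrder

variable {γ s u : ℝ}

lemma weight_eq_exp (hs : 0 < s) :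
    weight γ s u =
      Real.exp (-(γ * (Real.log (2 * Real.pi * s) / (2 * (1 + γ)) + u ^ 2 / (2 * s)))) := by
  rw [weight, Real.rpow_def_of_pos (by positivity), ← Real.exp_add]
  congr 1
  ring

lemma abs_weight_sub_one_le_of_abs_log_le {s1 L : ℝ} (hs1 : 0 < s1) (hs : s1 ≤ s)
    (hL : |Real.log (2 * Real.pi * s)| ≤ L) (hγ : γ ∈ Icc (0 : ℝ) 1) :
    |weight γ s u - 1| ≤ (L + 1 / (2 * s1)) * Real.exp L * γ * (1 + u ^ 2) ∧
      weight γ s u ≤ Real.exp L := by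
  have hL0 : 0 ≤ L := (abs_nonneg _).trans hL
  have hspos : 0 < s := hs1.trans_le hs
  obtain ⟨hγ0, hγ1⟩ := hγ
  rw [weight_eq_exp hspos]
  set t : ℝ := Real.log (2 * Real.pi * s) / (2 * (1 + γ)) + u ^ 2 / (2 * s)
  have hlog : |Real.log (2 * Real.pi * s) / (2 * (1 + γ))| ≤ L := by
    rw [abs_div, abs_of_pos (a := 2 * (1 + γ)) (by linarith)]
    exact (div_le_self (abs_nonneg _) (by linarith)).trans hL
  have hsq0 : 0 ≤ u ^ 2 / (2 * s) := by positivity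
  have hsq : u ^ 2 / (2 * s) ≤ 1 / (2 * s1) * u ^ 2 := by
    rw [one_div_mul_eq_div]
    gcongr
  have ht : |t| ≤ (L + 1 / (2 * s1)) * (1 + u ^ 2) := by
    have habs : |t| ≤ L + 1 / (2 * s1) * u ^ 2 :=
      (abs_add_le _ _).trans (add_le_add hlog ((abs_of_nonneg hsq0).trans_le hsq))
    have hrest : 0 ≤ L * u ^ 2 + 1 / (2 * s1) := by positivity
    linarith
  have hexpL : -(γ * t) ≤ L := by nlinarith [(abs_le.1 hlog).1]
  refine ⟨?_, Real.exp_le_exp.2 hexpL⟩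
  calc |Real.exp (-(γ * t)) - 1| ≤ |-(γ * t)| * Real.exp L :=
        abs_exp_sub_one_le_abs_mul_exp hL0 hexpL
    _ = γ * |t| * Real.exp L := by rw [abs_neg, abs_mul, abs_of_nonneg hγ0]
    _ ≤ γ * ((L + 1 / (2 * s1)) * (1 + u ^ 2)) * Real.exp L := by gcongr
    _ = (L + 1 / (2 * s1)) * Real.exp L * γ * (1 + u ^ 2) := by ring

lemma exists_abs_weight_sub_one_le {s1 : ℝ} (hs1 : 0 < s1) (s2 : ℝ) :
    ∃ K > 0, ∀ s ∈ Icc s1 s2, ∀ γ ∈ Icc (0 : ℝ) 1, ∀ u,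
      |weight γ s u - 1| ≤ K * γ * (1 + u ^ 2) ∧ weight γ s u ≤ K := by
  have hcont : ContinuousOn (fun s => Real.log (2 * Real.pi * s)) (Icc s1 s2) :=
    ContinuousOn.log (by fun_prop) fun s hs => (mul_pos Real.two_pi_pos (hs1.trans_le hs.1)).ne'
  obtain ⟨L, hL⟩ := isCompact_Icc.exists_bound_of_continuousOn hcont
  set K := (|L| + 1 / (2 * s1)) * Real.exp |L|
  have hK : K ≤ max K (Real.exp |L|) := le_max_left _ _
  refine ⟨max K (Real.exp |L|), by positivity, fun s hs γ hγ u => ?_⟩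
  obtain ⟨hdev, hle⟩ :=
    abs_weight_sub_one_le_of_abs_log_le (u := u) hs1 hs.1 ((hL s hs).trans (le_abs_self L)) hγ
  have hγ0 : 0 ≤ γ := hγ.1
  exact ⟨hdev.trans (by gcongr), hle.trans (le_max_right _ _)⟩

end FirstOrder

section PopulationWeight

/-- The mean of the weight `w_γ` with total variance `s` and centre `μ` under `N(μ', s')`, as a
function of `d = μ' - μ`. -/
def popWeight (γ s' s d : ℝ) : ℝ :=
  (2 * Real.pi * s) ^ (-(γ / (2 * (1 + γ)))) * √(s / (s + γ * s')) *
    Real.exp (-(γ * d ^ 2) / (2 * (s + γ * s')))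

variable {γ s s' d : ℝ}

lemma weight_eq_mul_gaussianPDFReal (hγ : 0 < γ) (hs : 0 < s) (μ y : ℝ) :
    weight γ s (y - μ) = (2 * Real.pi * s) ^ (-(γ / (2 * (1 + γ)))) *
      √(2 * Real.pi * (s / γ)) * gaussianPDFReal y (s / γ).toNNReal μ := by
  have hnorm : √(2 * Real.pi * (s / γ)) ≠ 0 := by positivity
  simp only [weight, gaussianPDFReal, Real.coe_toNNReal (s / γ) (by positivity)]
  rw [mul_assoc (_ ^ _) (√_), mul_inv_cancel_left₀ hnorm]
  congr 2
  field_simp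
  ring

lemma integral_weight_gaussianReal (hγ : 0 < γ) (hs : 0 < s) (hs' : 0 < s') (μ μ' : ℝ) :
    ∫ y, weight γ s (y - μ) ∂(gaussianReal μ' s'.toNNReal) = popWeight γ s' s (μ' - μ) := by
  have hr : 0 < s / γ := by positivity
  have ht : 0 < s' + s / γ := by positivity
  rw [integral_gaussianReal_eq_integral_smul (Real.toNNReal_pos.2 hs').ne']
  simp only [weight_eq_mul_gaussianPDFReal hγ hs, smul_eq_mul, mul_left_comm]
  rw [integral_const_mul, integral_gaussianPDFReal_mul_gaussianPDFReal hs' hr]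
  simp only [popWeight, gaussianPDFReal, Real.coe_toNNReal _ ht.le]
  have hsqrt : √(2 * Real.pi * (s / γ)) * (√(2 * Real.pi * (s' + s / γ)))⁻¹ =
      √(s / (s + γ * s')) := by
    rw [← Real.sqrt_inv, ← Real.sqrt_mul (by positivity)]
    congr 1
    field_simp
    ring
  have hexp : -(μ - μ') ^ 2 / (2 * (s' + s / γ)) = -(γ * (μ' - μ) ^ 2) / (2 * (s + γ * s')) := by
    field_simp
    ring
  rw [hexp, ← hsqrt]
  ring

lemma popWeight_pos (hγ : 0 < γ) (hs : 0 < s) (hs' : 0 < s') : 0 < popWeight γ s' s d := by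
  unfold popWeight
  positivity

lemma continuousOn_popWeight (hs' : 0 < s') :
    ContinuousOn (fun z : ℝ × ℝ × ℝ => popWeight z.1 s' z.2.1 z.2.2) (Ioi 0 ×ˢ Ioi 0 ×ˢ univ) := by
  have hden : ∀ z ∈ Ioi (0 : ℝ) ×ˢ Ioi (0 : ℝ) ×ˢ (univ : Set ℝ), 0 < z.2.1 + z.1 * s' :=
    fun z hz => add_pos hz.2.1 (mul_pos hz.1 hs')
  unfold popWeight
  refine ((ContinuousOn.rpow (by fun_prop) ?_ fun z hz => Or.inl ?_).mul
    (ContinuousOn.div (by fun_prop) (by fun_prop) fun z hz => (hden z hz).ne').sqrt).mul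
    (Real.continuous_exp.comp_continuousOn (ContinuousOn.div (by fun_prop) (by fun_prop)
      fun z hz => mul_ne_zero two_ne_zero (hden z hz).ne'))
  · exact (ContinuousOn.div (by fun_prop) (by fun_prop) fun z hz =>
      mul_ne_zero two_ne_zero (add_pos one_pos hz.1).ne').neg
  · exact (mul_pos Real.two_pi_pos hz.2.1).ne'

lemma log_popWeight_zero (hγ : 0 < γ) (hs : 0 < s) (hs' : 0 < s') :
    Real.log (popWeight γ s' s 0) =
      -(γ / (2 * (1 + γ))) * (Real.log (2 * Real.pi) + Real.log s) +
        (Real.log s - Real.log (s + γ * s')) / 2 := by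
  have hsum : 0 < s + γ * s' := by positivity
  simp only [popWeight, ne_eq, OfNat.ofNat_ne_zero, not_false_eq_true, zero_pow, mul_zero,
    neg_zero, zero_div, Real.exp_zero, mul_one]
  rw [Real.log_mul (by positivity) (by positivity), Real.log_rpow (by positivity),
    Real.log_mul (by positivity) hs.ne', Real.log_sqrt (by positivity),
    Real.log_div hs.ne' hsum.ne']

lemma popWeight_zero_lt (hγ : 0 < γ) (hs : 0 < s) (hs' : 0 < s') (hne : s ≠ s') :
    popWeight γ s' s 0 < popWeight γ s' s' 0 := by
  rw [← Real.log_lt_log_iff (popWeight_pos hγ hs hs') (popWeight_pos hγ hs' hs'),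
    log_popWeight_zero hγ hs hs', log_popWeight_zero hγ hs' hs']
  have hconc : (1 - γ / (1 + γ)) * Real.log s + γ / (1 + γ) * Real.log s' <
      Real.log ((1 - γ / (1 + γ)) * s + γ / (1 + γ) * s') :=
    strictConcaveOn_log_Ioi.2 hs hs' hne (by rw [sub_pos, div_lt_one] <;> linarith)
      (by positivity) (by ring)
  have hmix : (1 - γ / (1 + γ)) * s + γ / (1 + γ) * s' = (s + γ * s') / (1 + γ) := by
    field_simp
    ring
  rw [hmix, Real.log_div (by positivity) (by positivity)] at hconc
  have hhalf : γ / (2 * (1 + γ)) = γ / (1 + γ) / 2 := by field_simp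
  rw [show s' + γ * s' = s' * (1 + γ) by ring, Real.log_mul hs'.ne' (by positivity), hhalf]
  linarith

lemma popWeight_lt_of_ne (hγ : 0 < γ) (hs : 0 < s) (hs' : 0 < s') (hd : d ≠ 0) :
    popWeight γ s' s d < popWeight γ s' s 0 := by
  unfold popWeight
  have hd2 : 0 < γ * d ^ 2 := by positivity
  gcongr ?_ * Real.exp ?_
  simpa using div_neg_of_neg_of_pos (neg_lt_zero.2 hd2) (by positivity)

lemma popWeight_le (hγ : 0 < γ) (hs : 0 < s) (hs' : 0 < s') :
    popWeight γ s' s d ≤ popWeight γ s' s' 0 := by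
  calc popWeight γ s' s d ≤ popWeight γ s' s 0 := by
        rcases eq_or_ne d 0 with rfl | hd
        · exact le_rfl
        · exact (popWeight_lt_of_ne hγ hs hs' hd).le
    _ ≤ popWeight γ s' s' 0 := by
        rcases eq_or_ne s s' with rfl | hne
        · exact le_rfl
        · exact (popWeight_zero_lt hγ hs hs' hne).le

lemma popWeight_eq_iff (hγ : 0 < γ) (hs : 0 < s) (hs' : 0 < s') :
    popWeight γ s' s d = popWeight γ s' s' 0 ↔ s = s' ∧ d = 0 := by
  refine ⟨fun h => ?_, fun ⟨hss, hd⟩ => by rw [hss, hd]⟩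
  have hd : d = 0 := by
    by_contra hd
    exact ((popWeight_lt_of_ne hγ hs hs' hd).trans_le (popWeight_le hγ hs hs')).ne h
  subst hd
  exact ⟨by_contra fun hne => (popWeight_zero_lt hγ hs hs' hne).ne h, rfl⟩

end PopulationWeight

/-! ### The law of one area -/

section Lin

lemma lin_eq_inner (x β : Cov p) : lin x β = inner ℝ β x := by
  simp [lin, PiLp.inner_apply]

lemma abs_lin_le (x β : Cov p) : |lin x β| ≤ ‖x‖ * ‖β‖ := by
  rw [lin_eq_inner, mul_comm]
  exact abs_real_inner_le_norm β x

lemma abs_lin_sub_le (x β β' : Cov p) : |lin x β - lin x β'| ≤ ‖x‖ * ‖β - β'‖ := by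
  rw [lin_eq_inner, lin_eq_inner, ← inner_sub_left, mul_comm]
  exact abs_real_inner_le_norm _ x

lemma measurable_lin {X : Type*} [MeasurableSpace X] {f : X → Cov p} (hf : Measurable f)
    (β : Cov p) : Measurable fun z => lin (f z) β := by
  unfold lin
  fun_prop

end Lin

/-- The data `(((x, D), θ), y)` of one area. -/
abbrev Area (p : ℕ) := ((Cov p × ℝ) × ℝ) × ℝ

section AreaLaw

instance : IsMarkovKernel (obsKernel p) :=
  ⟨fun z => inferInstanceAs (IsProbabilityMeasure (gaussianReal z.2 z.1.2.toNNReal))⟩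

lemma abs_integral_le_of_abs_le {X : Type*} [MeasurableSpace X] {μ : Measure X}
    [IsProbabilityMeasure μ] {f : X → ℝ} {B : ℝ} (h : ∀ x, |f x| ≤ B) : |∫ x, f x ∂μ| ≤ B := by
  simpa using norm_integral_le_of_norm_le_const (μ := μ) (f := f) (.of_forall h)

lemma abs_integral_le_integral_of_abs_le {X : Type*} [MeasurableSpace X] {μ : Measure X}
    {f g : X → ℝ} (hg : Integrable g μ) (h : ∀ x, |f x| ≤ g x) : |∫ x, f x ∂μ| ≤ ∫ x, g x ∂μ :=
  norm_integral_le_of_norm_le (f := f) hg (.of_forall h)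

lemma stronglyMeasurable_integral_gaussianReal (D : ℝ) {f : ℝ → ℝ → ℝ}
    (hf : Measurable (Function.uncurry f)) :
    StronglyMeasurable fun θ => ∫ y, f θ y ∂(gaussianReal θ D.toNNReal) := by
  let κ : Kernel ℝ ℝ :=
    ⟨fun θ => gaussianReal θ D.toNNReal,
      measurable_gaussianReal.comp (measurable_id.prodMk measurable_const)⟩
  have : IsMarkovKernel κ :=
    ⟨fun θ => inferInstanceAs (IsProbabilityMeasure (gaussianReal θ D.toNNReal))⟩
  exact hf.stronglyMeasurable.integral_kernel_prod_right (κ := κ)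

/-- The conditional mean of `f` given `(x, D) = z`, when `θ` has law `τ`. -/
def condMean (f : Area p → ℝ) (τ : Measure ℝ) (z : Cov p × ℝ) : ℝ :=
  ∫ θ, ∫ y, f ((z, θ), y) ∂(gaussianReal θ z.2.toNNReal) ∂τ

variable (ν : Measure (Cov p × ℝ)) [IsProbabilityMeasure ν] (β : Cov p) (A : ℝ) {ω : ℝ}
  (hω : ω ∈ Icc (0 : ℝ) 1) (δ : Measure ℝ) [IsProbabilityMeasure δ]

include hω

lemma isMarkovKernel_thetaKernel : IsMarkovKernel (thetaKernel β A ω δ) := by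
  refine ⟨fun z => ⟨?_⟩⟩
  change (ENNReal.ofReal (1 - ω) • gaussianReal (lin z.1 β) A.toNNReal +
    ENNReal.ofReal ω • δ) univ = 1
  simp only [Measure.coe_add, Measure.coe_smul, Pi.add_apply, Pi.smul_apply, measure_univ,
    smul_eq_mul, mul_one]
  rw [← ENNReal.ofReal_add (by linarith [hω.2]) hω.1, sub_add_cancel, ENNReal.ofReal_one]

lemma isProbabilityMeasure_areaLaw : IsProbabilityMeasure (areaLaw ν β A ω δ) := by
  have := isMarkovKernel_thetaKernel β A hω δ
  unfold areaLaw
  infer_instance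

variable {ν} in
lemma ae_areaLaw {q : Cov p × ℝ → Prop} (hq : ∀ᵐ z ∂ν, q z) :
    ∀ᵐ t ∂(areaLaw ν β A ω δ), q t.1.1 := by
  have := isMarkovKernel_thetaKernel β A hω δ
  have hfst : (areaLaw ν β A ω δ).fst.fst = ν := by
    rw [areaLaw, Measure.fst_compProd, Measure.fst_compProd]
  rw [← hfst] at hq
  exact ae_of_ae_map measurable_fst.aemeasurable (ae_of_ae_map measurable_fst.aemeasurable hq)

lemma integral_thetaKernel {g : ℝ → ℝ} (hg : StronglyMeasurable g) {B : ℝ} (hB : ∀ θ, |g θ| ≤ B)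
    (z : Cov p × ℝ) :
    ∫ θ, g θ ∂(thetaKernel β A ω δ z) =
      (1 - ω) * ∫ θ, g θ ∂(gaussianReal (lin z.1 β) A.toNNReal) + ω * ∫ θ, g θ ∂δ := by
  have hint (τ : Measure ℝ) [IsFiniteMeasure τ] : Integrable g τ :=
    .of_bound hg.aestronglyMeasurable B (.of_forall hB)
  change ∫ θ, g θ ∂(ENNReal.ofReal (1 - ω) • gaussianReal (lin z.1 β) A.toNNReal +
    ENNReal.ofReal ω • δ) = _
  rw [integral_add_measure ((hint _).smul_measure ENNReal.ofReal_ne_top)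
    ((hint _).smul_measure ENNReal.ofReal_ne_top), integral_smul_measure, integral_smul_measure,
    ENNReal.toReal_ofReal (by linarith [hω.2]), ENNReal.toReal_ofReal hω.1, smul_eq_mul,
    smul_eq_mul]

variable {f : Area p → ℝ} (hf : Measurable f) {B : ℝ} (hB : ∀ t, |f t| ≤ B)

include hf hB

lemma integral_areaLaw :
    Integrable (fun z => (1 - ω) * condMean f (gaussianReal (lin z.1 β) A.toNNReal) z +
      ω * condMean f δ z) ν ∧
    ∫ t, f t ∂(areaLaw ν β A ω δ) =
      ∫ z, ((1 - ω) * condMean f (gaussianReal (lin z.1 β) A.toNNReal) z +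
        ω * condMean f δ z) ∂ν := by
  have := isMarkovKernel_thetaKernel β A hω δ
  have := isProbabilityMeasure_areaLaw ν β A hω δ
  have hfi : Integrable f (areaLaw ν β A ω δ) :=
    .of_bound hf.aestronglyMeasurable B (.of_forall hB)
  unfold areaLaw at hfi ⊢
  have hg : StronglyMeasurable fun s : (Cov p × ℝ) × ℝ => ∫ y, f (s, y) ∂(obsKernel p s) :=
    hf.stronglyMeasurable.integral_kernel_prod_right'
  have hgB (s : (Cov p × ℝ) × ℝ) : |∫ y, f (s, y) ∂(obsKernel p s)| ≤ B :=
    abs_integral_le_of_abs_le fun y => hB (s, y)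
  have hgi : Integrable (fun s : (Cov p × ℝ) × ℝ => ∫ y, f (s, y) ∂(obsKernel p s))
      (ν ⊗ₘ thetaKernel β A ω δ) :=
    .of_bound hg.aestronglyMeasurable B (.of_forall hgB)
  have hcond (z : Cov p × ℝ) : ∫ θ, ∫ y, f ((z, θ), y) ∂(obsKernel p (z, θ))
      ∂(thetaKernel β A ω δ z) =
      (1 - ω) * condMean f (gaussianReal (lin z.1 β) A.toNNReal) z + ω * condMean f δ z :=
    integral_thetaKernel β A hω δ (hg.comp_measurable measurable_prodMk_left)
      (fun θ => hgB (z, θ)) z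
  have hgi' : Integrable (fun z => ∫ θ, ∫ y, f ((z, θ), y) ∂(obsKernel p (z, θ))
      ∂(thetaKernel β A ω δ z)) ν := hgi.integral_compProd
  rw [Measure.integral_compProd hfi, Measure.integral_compProd hgi]
  simp only [hcond] at hgi' ⊢
  exact ⟨hgi', trivial⟩

lemma abs_integral_areaLaw_le {b c : ℝ}
    (hb : ∀ᵐ z ∂ν, |condMean f (gaussianReal (lin z.1 β) A.toNNReal) z| ≤ b)
    (hc : ∀ᵐ z ∂ν, ω * |condMean f δ z| ≤ c) :
    |∫ t, f t ∂(areaLaw ν β A ω δ)| ≤ b + c := by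
  rw [(integral_areaLaw ν β A hω δ hf hB).2]
  have hbc : ∀ᵐ z ∂ν, ‖(1 - ω) * condMean f (gaussianReal (lin z.1 β) A.toNNReal) z +
      ω * condMean f δ z‖ ≤ b + c := by
    filter_upwards [hb, hc] with z hz hz'
    refine (norm_add_le _ _).trans (add_le_add ?_ ?_)
    · rw [norm_mul, Real.norm_eq_abs, Real.norm_eq_abs, abs_of_nonneg (by linarith [hω.2])]
      exact (mul_le_of_le_one_left (abs_nonneg _) (by linarith [hω.1])).trans hz
    · rwa [norm_mul, Real.norm_eq_abs, Real.norm_eq_abs, abs_of_nonneg hω.1]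
  simpa using norm_integral_le_of_norm_le_const hbc

end AreaLaw

section Phi

variable {y μ s : ℝ}

lemma phi_nonneg (y μ s : ℝ) : 0 ≤ phi y μ s := gaussianPDFReal_nonneg _ _ _

lemma measurable_phi (μ s : ℝ) : Measurable fun y => phi y μ s := measurable_gaussianPDFReal _ _

lemma phi_le {s1 : ℝ} (hs1 : 0 < s1) (hs : s1 ≤ s) :
    phi y μ s ≤ (2 * Real.pi * s1) ^ (-(1 / 2) : ℝ) := by
  have hs0 : 0 < s := hs1.trans_le hs
  have hexp : Real.exp (-(y - μ) ^ 2 / (2 * s)) ≤ 1 :=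
    Real.exp_le_one_iff.2 (div_nonpos_of_nonpos_of_nonneg (by nlinarith [sq_nonneg (y - μ)])
      (by positivity))
  rw [phi_eq hs0]
  exact (mul_le_of_le_one_right (by positivity) hexp).trans
    (Real.rpow_le_rpow_of_nonpos (by positivity) (by gcongr) (by norm_num))

lemma abs_phi_rpow_le {s1 γ : ℝ} (hs1 : 0 < s1) (hs : s1 ≤ s) (hγ : 0 ≤ γ) :
    |phi y μ s ^ γ| ≤ ((2 * Real.pi * s1) ^ (-(1 / 2) : ℝ)) ^ γ := by
  rw [abs_of_nonneg (Real.rpow_nonneg (phi_nonneg _ _ _) _)]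
  exact Real.rpow_le_rpow (phi_nonneg _ _ _) (phi_le hs1 hs) hγ

lemma le_phi {s1 s2 M : ℝ} (hs1 : 0 < s1) (hs : s ∈ Icc s1 s2) (hM : |y - μ| ≤ M) :
    (2 * Real.pi * s2) ^ (-(1 / 2) : ℝ) * Real.exp (-M ^ 2 / (2 * s1)) ≤ phi y μ s := by
  have hs0 : 0 < s := hs1.trans_le hs.1
  have hsq : (y - μ) ^ 2 ≤ M ^ 2 := by
    rw [← sq_abs (y - μ)]
    gcongr
  have hexp : -M ^ 2 / (2 * s1) ≤ -(y - μ) ^ 2 / (2 * s) := by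
    rw [neg_div, neg_div, neg_le_neg_iff]
    gcongr
    exact hs.1
  rw [phi_eq hs0]
  exact mul_le_mul (Real.rpow_le_rpow_of_nonpos (by positivity) (by gcongr; exact hs.2)
    (by norm_num)) (Real.exp_le_exp.2 hexp) (by positivity) (by positivity)

end Phi

section Contamination

/-- The probability that `|y| ≤ R` when `θ ∼ δ` and the sampling variance is `D`. -/
def contamMass (δ : Measure ℝ) (D R : ℝ) : ℝ :=
  ∫ θ, (gaussianReal θ D.toNNReal).real (Icc (-R) R) ∂δ

lemma integrable_gaussianReal_real_Icc (δ : Measure ℝ) [IsProbabilityMeasure δ] (D R : ℝ) :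
    Integrable (fun θ => (gaussianReal θ D.toNNReal).real (Icc (-R) R)) δ := by
  have hm := stronglyMeasurable_integral_gaussianReal D
    (f := fun _ y => (Icc (-R) R).indicator (1 : ℝ → ℝ) y)
    ((measurable_one.indicator measurableSet_Icc).comp measurable_snd)
  simp only [integral_indicator_one measurableSet_Icc] at hm
  exact .of_bound hm.aestronglyMeasurable 1 (.of_forall fun θ =>
    (Real.norm_of_nonneg measureReal_nonneg).trans_le measureReal_le_one)

lemma abs_condMean_le_mul_contamMass_add {f : Area p → ℝ} (δ : Measure ℝ) [IsProbabilityMeasure δ]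
    {z : Cov p × ℝ} {W R ε : ℝ} (h : ∀ θ, |∫ y, f ((z, θ), y) ∂(gaussianReal θ z.2.toNNReal)| ≤
      W * (gaussianReal θ z.2.toNNReal).real (Icc (-R) R) + ε) :
    |condMean f δ z| ≤ W * contamMass δ z.2 R + ε := by
  have hint := (integrable_gaussianReal_real_Icc δ z.2 R).const_mul W
  refine (abs_integral_le_integral_of_abs_le (hint.add (integrable_const ε)) h).trans_eq ?_
  simp only [Pi.add_apply]
  rw [integral_add hint (integrable_const ε), integral_const_mul, integral_const, probReal_univ,
    one_smul, contamMass]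

lemma rho_nonneg (𝒳 : Set (Cov p)) (DL DU : ℝ) (β : Cov p) (A γ : ℝ) (δ : Measure ℝ) :
    0 ≤ rho 𝒳 DL DU β A γ δ :=
  Real.iSup_nonneg fun _ => Real.iSup_nonneg fun _ => Real.iSup_nonneg fun _ =>
    integral_nonneg fun _ => mul_nonneg (mul_nonneg (integral_nonneg fun _ => phi_nonneg _ _ _)
      (Real.rpow_nonneg (phi_nonneg _ _ _) _)) (by positivity)

variable (δ : Measure ℝ) [IsProbabilityMeasure δ]

lemma integral_margDens_mul {D : ℝ} (hD : 0 < D) {g : ℝ → ℝ} (hg : Measurable g) {B : ℝ}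
    (hB : ∀ y, |g y| ≤ B) :
    ∫ y, margDens δ D y * g y = ∫ θ, ∫ y, g y ∂(gaussianReal θ D.toNNReal) ∂δ := by
  have hD' : D.toNNReal ≠ 0 := (Real.toNNReal_pos.2 hD).ne'
  simp only [integral_gaussianReal_eq_integral_smul hD', smul_eq_mul, margDens, phi,
    ← integral_mul_const]
  refine (integral_integral_swap ?_).symm
  have hmeas : Measurable fun z : ℝ × ℝ => gaussianPDFReal z.1 D.toNNReal z.2 :=
    measurable_gaussianPDFReal_comp measurable_fst measurable_snd
  have hint : Integrable (fun z : ℝ × ℝ => gaussianPDFReal z.1 D.toNNReal z.2)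
      (δ.prod volume) := by
    rw [integrable_prod_iff hmeas.aestronglyMeasurable]
    refine ⟨.of_forall fun θ => integrable_gaussianPDFReal _ _, ?_⟩
    refine (integrable_const (1 : ℝ)).congr (.of_forall fun θ => ?_)
    simp only [Real.norm_eq_abs, abs_of_nonneg (gaussianPDFReal_nonneg _ _ _)]
    rw [integral_gaussianPDFReal_eq_one _ hD']
  exact hint.mul_bdd (c := B) (hg.comp measurable_snd).aestronglyMeasurable
    (.of_forall fun z => hB z.2)

lemma mul_contamMass_le_integral_margDens_mul {D : ℝ} (hD : 0 < D) {g : ℝ → ℝ}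
    (hg : Measurable g) {B : ℝ} (hB : ∀ y, |g y| ≤ B) (hg0 : ∀ y, 0 ≤ g y) {c R : ℝ} (hc : 0 ≤ c)
    (hcg : ∀ y ∈ Icc (-R) R, c ≤ g y) :
    c * contamMass δ D R ≤ ∫ y, margDens δ D y * g y := by
  rw [integral_margDens_mul δ hD hg hB, contamMass, ← integral_const_mul]
  have hint : Integrable (fun θ => ∫ y, g y ∂(gaussianReal θ D.toNNReal)) δ :=
    .of_bound (stronglyMeasurable_integral_gaussianReal D (f := fun _ y => g y)
      (hg.comp measurable_snd)).aestronglyMeasurable B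
      (.of_forall fun _ => abs_integral_le_of_abs_le hB)
  refine integral_mono_of_nonneg (.of_forall fun θ => by positivity) hint (.of_forall fun θ => ?_)
  beta_reduce
  rw [← integral_indicator_one measurableSet_Icc, ← integral_const_mul]
  refine integral_mono_of_nonneg (.of_forall fun y => ?_)
    (.of_bound hg.aestronglyMeasurable B (.of_forall hB)) (.of_forall fun y => ?_)
  · exact mul_nonneg hc (indicator_nonneg (fun _ _ => zero_le_one) _)
  · by_cases hy : y ∈ Icc (-R) R
    · simpa [indicator_of_mem hy] using hcg y hy
    · simpa [indicator_of_notMem hy] using hg0 y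

variable {𝒳 : Set (Cov p)} {DL DU : ℝ} (hDL : 0 < DL) (β : Cov p) {A : ℝ} (hA : 0 < A)

include hDL hA

lemma integral_margDens_mul_phi_le_rho {γ : ℝ} (hγ : 0 ≤ γ) {x : Cov p} (hx : x ∈ 𝒳) {D : ℝ}
    (hD : D ∈ Icc DL DU) :
    ∫ y, margDens δ D y * phi y (lin x β) (A + D) ^ γ ≤ rho 𝒳 DL DU β A γ δ := by
  set M : ℝ := ((2 * Real.pi * (A + DL)) ^ (-(1 / 2) : ℝ)) ^ γ
  let I (D : ℝ) (x : Cov p) (k : Fin 3) : ℝ :=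
    ∫ y, margDens δ D y * phi y (lin x β) (A + D) ^ γ * |y - lin x β| ^ (k : ℕ)
  have hI (D : ℝ) (x : Cov p) : I D x 0 = ∫ y, margDens δ D y * phi y (lin x β) (A + D) ^ γ := by
    simp only [I, Fin.val_zero, pow_zero, mul_one]
  have hbd : ∀ D ∈ Icc DL DU, ∀ x, I D x 0 ≤ M := by
    intro D hD x
    have hb (y : ℝ) : |phi y (lin x β) (A + D) ^ γ| ≤ M :=
      abs_phi_rpow_le (by positivity) (by linarith [hD.1]) hγ
    rw [hI, integral_margDens_mul δ (hDL.trans_le hD.1) ((measurable_phi _ _).pow_const γ) hb]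
    exact (le_abs_self _).trans (abs_integral_le_of_abs_le fun θ => abs_integral_le_of_abs_le hb)
  calc ∫ y, margDens δ D y * phi y (lin x β) (A + D) ^ γ = I D x 0 := (hI D x).symm
    _ ≤ ⨆ x : 𝒳, I D x 0 :=
        le_ciSup (f := fun x : 𝒳 => I D x 0) ⟨M, by rintro _ ⟨x, rfl⟩; exact hbd D hD x⟩ ⟨x, hx⟩
    _ ≤ ⨆ D : Icc DL DU, ⨆ x : 𝒳, I D x 0 :=
        le_ciSup (f := fun D : Icc DL DU => ⨆ x : 𝒳, I D x 0) ⟨M, by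
          rintro _ ⟨D, rfl⟩
          exact Real.iSup_le (fun x => hbd D D.2 x) (by positivity)⟩ ⟨D, hD⟩
    _ ≤ rho 𝒳 DL DU β A γ δ :=
        le_ciSup (f := fun k => ⨆ D : Icc DL DU, ⨆ x : 𝒳, I D x k) (finite_range _).bddAbove 0

omit δ [IsProbabilityMeasure δ] in
lemma exists_le_phi_rpow (h𝒳 : Bornology.IsBounded 𝒳) (DU R : ℝ) :
    ∃ c > 0, ∀ γ ∈ Icc (0 : ℝ) 1, ∀ x ∈ 𝒳, ∀ D ∈ Icc DL DU, ∀ y ∈ Icc (-R) R,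
      c ≤ phi y (lin x β) (A + D) ^ γ := by
  obtain ⟨L, hL⟩ := h𝒳.exists_norm_le
  set q : ℝ := (2 * Real.pi * (A + |DU|)) ^ (-(1 / 2) : ℝ) *
    Real.exp (-(R + L * ‖β‖) ^ 2 / (2 * (A + DL)))
  have hq : 0 < min q 1 := by positivity
  refine ⟨min q 1, hq, fun γ hγ x hx D hD y hy => ?_⟩
  have hdist : |y - lin x β| ≤ R + L * ‖β‖ := by
    calc |y - lin x β| ≤ |y| + |lin x β| := abs_sub _ _
      _ ≤ R + ‖x‖ * ‖β‖ := add_le_add (abs_le.2 hy) (abs_lin_le x β)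
      _ ≤ R + L * ‖β‖ := by
          gcongr
          exact hL x hx
  have hphi : q ≤ phi y (lin x β) (A + D) :=
    le_phi (by positivity) ⟨by linarith [hD.1], by linarith [hD.2, le_abs_self DU]⟩ hdist
  calc min q 1 = min q 1 ^ (1 : ℝ) := (Real.rpow_one _).symm
    _ ≤ min q 1 ^ γ := Real.rpow_le_rpow_of_exponent_ge hq (min_le_right _ _) hγ.2
    _ ≤ phi y (lin x β) (A + D) ^ γ :=
        Real.rpow_le_rpow hq.le ((min_le_left _ _).trans hphi) hγ.1

omit δ [IsProbabilityMeasure δ] in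
lemma exists_contamMass_le_rho_div (h𝒳 : Bornology.IsBounded 𝒳) (DU R : ℝ) :
    ∃ c > 0, ∀ γ ∈ Icc (0 : ℝ) 1, ∀ δ : Measure ℝ, IsProbabilityMeasure δ → ∀ x ∈ 𝒳,
      ∀ D ∈ Icc DL DU, contamMass δ D R ≤ rho 𝒳 DL DU β A γ δ / c := by
  obtain ⟨c, hc, hphi⟩ := exists_le_phi_rpow hDL β hA h𝒳 DU R
  refine ⟨c, hc, fun γ hγ δ _ x hx D hD => ?_⟩
  rw [le_div_iff₀' hc]
  exact (mul_contamMass_le_integral_margDens_mul δ (hDL.trans_le hD.1)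
    ((measurable_phi _ _).pow_const γ)
    (fun y => abs_phi_rpow_le (s1 := A + DL) (by positivity) (by linarith [hD.1]) hγ.1)
    (fun y => Real.rpow_nonneg (phi_nonneg _ _ _) γ) hc.le (hphi γ hγ x hx D hD)).trans
      (integral_margDens_mul_phi_le_rho δ hDL β hA hγ.1 hx hD)

end Contamination

section Measurability

variable (γ : ℝ) (ψ : Param p)

lemma measurable_wGamma : Measurable fun t : Area p => wGamma γ ψ t.1.1.1 t.1.1.2 t.2 := by
  have hphi : Measurable fun t : Area p => phi t.2 (lin t.1.1.1 ψ.1) (ψ.2 + t.1.1.2) := by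
    have hlin : Measurable fun t : Area p => lin t.1.1.1 ψ.1 := measurable_lin (by fun_prop) _
    have hargs : Measurable fun t : Area p =>
      (lin t.1.1.1 ψ.1, (ψ.2 + t.1.1.2).toNNReal, t.2) := by fun_prop
    exact measurable_uncurry_gaussianPDFReal.comp hargs
  unfold wGamma cGamma
  fun_prop

lemma measurable_thetaTilde : Measurable fun t : Area p => thetaTilde γ ψ t.1.1.1 t.1.1.2 t.2 := by
  have hlin : Measurable fun t : Area p => lin t.1.1.1 ψ.1 := measurable_lin (by fun_prop) _
  have hw := measurable_wGamma γ ψ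
  unfold thetaTilde
  fun_prop

lemma measurable_sTildeSq : Measurable fun t : Area p => sTildeSq γ ψ t.1.1.1 t.1.1.2 t.2 := by
  have hlin : Measurable fun t : Area p => lin t.1.1.1 ψ.1 := measurable_lin (by fun_prop) _
  have hw := measurable_wGamma γ ψ
  unfold sTildeSq
  fun_prop

/-- The event that `θ` lies in the interval with half-width enlarged by `κ`; the nominal event is
sandwiched between two of these at the true parameter. -/
def coverSet (α γ : ℝ) (ψ : Param p) (κ : ℝ) : Set (Area p) :=
  {t | |t.1.2 - thetaTilde γ ψ t.1.1.1 t.1.1.2 t.2| <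
    zUpper (α / 2) * √(sTildeSq γ ψ t.1.1.1 t.1.1.2 t.2) + κ}

lemma measurableSet_coverSet (α κ : ℝ) : MeasurableSet (coverSet α γ ψ κ) := by
  have hθ := measurable_thetaTilde γ ψ
  have hs := measurable_sTildeSq γ ψ
  exact measurableSet_lt (measurable_norm.comp ((measurable_snd.comp measurable_fst).sub hθ))
    (by fun_prop)

end Measurability

/-! ### Coverage at the true parameter -/

section Endpoints

variable {A D γ u c : ℝ}

lemma one_add_sq_le (u : ℝ) : 1 + u ^ 2 ≤ 2 * (1 + |u| ^ 3) := by
  rw [← sq_abs]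
  nlinarith [sq_nonneg (|u| - 1), mul_nonneg (abs_nonneg u) (sq_nonneg (|u| - 1))]

lemma one_add_sq_mul_abs_le (u : ℝ) : (1 + u ^ 2) * |u| ≤ 2 * (1 + |u| ^ 3) := by
  have hu : 0 ≤ |u| := abs_nonneg u
  rw [← sq_abs]
  nlinarith [sq_nonneg (|u| - 1), mul_nonneg hu (sq_nonneg (|u| - 1)), mul_nonneg (mul_nonneg hu hu)
    hu]

lemma div_add_mem_Icc (hA : 0 < A) (hD : 0 < D) : D / (A + D) ∈ Icc (0 : ℝ) 1 :=
  ⟨by positivity, (div_le_one (by positivity)).2 (by linarith)⟩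

lemma abs_shift_sub_le (hA : 0 < A) (hD : 0 < D) (hc : 0 ≤ c)
    (hw : |weight γ (A + D) u - 1| ≤ c * (1 + u ^ 2)) :
    |shift γ (A + D) D u - D / (A + D) * u| ≤ 2 * c * (1 + |u| ^ 3) := by
  obtain ⟨hq0, hq1⟩ := div_add_mem_Icc hA hD
  have hfactor : shift γ (A + D) D u - D / (A + D) * u =
      (weight γ (A + D) u - 1) * (D / (A + D)) * u := by
    rw [shift]
    ring
  calc |shift γ (A + D) D u - D / (A + D) * u|
      = |weight γ (A + D) u - 1| * (D / (A + D)) * |u| := by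
        rw [hfactor, abs_mul, abs_mul, abs_of_nonneg hq0]
    _ ≤ c * (1 + u ^ 2) * 1 * |u| := by gcongr
    _ = c * ((1 + u ^ 2) * |u|) := by ring
    _ ≤ c * (2 * (1 + |u| ^ 3)) := mul_le_mul_of_nonneg_left (one_add_sq_mul_abs_le u) hc
    _ = 2 * c * (1 + |u| ^ 3) := by ring

lemma abs_add_varShift_sub_le (hA : 0 < A) (hD : 0 < D) (hγ : 0 ≤ γ)
    (hw : |weight γ (A + D) u - 1| ≤ c * (1 + u ^ 2)) (hwγ : weight γ (A + D) u * γ ≤ c) :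
    |D + varShift γ (A + D) D u - A * D / (A + D)| ≤ (1 + (A + D)) * c * (1 + u ^ 2) := by
  have hs : 0 < A + D := by positivity
  have hw0 : 0 < weight γ (A + D) u := weight_pos hs
  have hc : 0 ≤ c := (by positivity : 0 ≤ weight γ (A + D) u * γ).trans hwγ
  obtain ⟨hq0, hq1⟩ := div_add_mem_Icc hA hD
  have hfactor : D + varShift γ (A + D) D u - A * D / (A + D) = (D / (A + D)) ^ 2 *
      (weight γ (A + D) u * γ * u ^ 2 - (A + D) * (weight γ (A + D) u - 1)) := by
    rw [varShift]
    field_simp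
    ring
  have hquad : |weight γ (A + D) u * γ * u ^ 2| ≤ c * (1 + u ^ 2) := by
    rw [abs_of_nonneg (by positivity)]
    gcongr
    exact le_add_of_nonneg_left zero_le_one
  have hlin : |(A + D) * (weight γ (A + D) u - 1)| ≤ (A + D) * (c * (1 + u ^ 2)) := by
    rw [abs_mul, abs_of_pos hs]
    gcongr
  rw [hfactor, abs_mul, abs_of_nonneg (by positivity)]
  calc (D / (A + D)) ^ 2 *
        |weight γ (A + D) u * γ * u ^ 2 - (A + D) * (weight γ (A + D) u - 1)|
      ≤ 1 * (c * (1 + u ^ 2) + (A + D) * (c * (1 + u ^ 2))) := by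
        gcongr
        · exact pow_le_one₀ hq0 hq1
        · exact (abs_sub _ _).trans (add_le_add hquad hlin)
    _ = (1 + (A + D)) * c * (1 + u ^ 2) := by ring

lemma mul_div_add_le_mul_div_add {DL DU : ℝ} (hA : 0 < A) (hDL : 0 < DL) (hD : D ∈ Icc DL DU) :
    A * DL / (A + |DU|) ≤ A * D / (A + D) := by
  obtain ⟨hD1, hD2⟩ := hD
  have hD0 : 0 < D := hDL.trans_le hD1
  have hDU : D ≤ |DU| := hD2.trans (le_abs_self _)
  gcongr

lemma abs_sqrt_add_varShift_sub_le {DL DU : ℝ} (hA : 0 < A) (hDL : 0 < DL) (hD : D ∈ Icc DL DU)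
    (hγ : 0 ≤ γ) (hw : |weight γ (A + D) u - 1| ≤ c * (1 + u ^ 2))
    (hwγ : weight γ (A + D) u * γ ≤ c) :
    |√(D + varShift γ (A + D) D u) - √(A * D / (A + D))| ≤
      2 * (1 + (A + |DU|)) / √(A * DL / (A + |DU|)) * c * (1 + |u| ^ 3) := by
  have hD0 : 0 < D := hDL.trans_le hD.1
  have hw0 : 0 < weight γ (A + D) u := weight_pos (by positivity)
  have hc : 0 ≤ c := (by positivity : 0 ≤ weight γ (A + D) u * γ).trans hwγ
  have hv : A * DL / (A + |DU|) ≤ A * D / (A + D) := mul_div_add_le_mul_div_add hA hDL hD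
  have hDU : D ≤ |DU| := hD.2.trans (le_abs_self _)
  calc |√(D + varShift γ (A + D) D u) - √(A * D / (A + D))|
      ≤ |D + varShift γ (A + D) D u - A * D / (A + D)| / √(A * D / (A + D)) :=
        abs_sqrt_sub_sqrt_le_div (by positivity)
    _ ≤ (1 + (A + D)) * c * (1 + u ^ 2) / √(A * D / (A + D)) := by
        gcongr
        exact abs_add_varShift_sub_le hA hD0 hγ hw hwγ
    _ ≤ (1 + (A + |DU|)) * c * (2 * (1 + |u| ^ 3)) / √(A * DL / (A + |DU|)) := by
        gcongr
        exact one_add_sq_le u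
    _ = 2 * (1 + (A + |DU|)) / √(A * DL / (A + |DU|)) * c * (1 + |u| ^ 3) := by ring

/-- At the true parameter the interval is within `O(γ)` of the Bayes interval. -/
lemma exists_endpoint_bound {DL : ℝ} (hDL : 0 < DL) (DU : ℝ) (hA : 0 < A) (ζ : ℝ) :
    ∃ K > 0, ∀ γ ∈ Icc (0 : ℝ) 1, ∀ D ∈ Icc DL DU, ∀ u,
      |shift γ (A + D) D u - D / (A + D) * u| +
        |ζ| * |√(D + varShift γ (A + D) D u) - √(A * D / (A + D))| ≤ K * γ * (1 + |u| ^ 3) := by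
  obtain ⟨K, hK0, hK⟩ :=
    exists_abs_weight_sub_one_le (s1 := A + DL) (by positivity) (A + DU)
  refine ⟨(2 + |ζ| * (2 * (1 + (A + |DU|)) / √(A * DL / (A + |DU|)))) * K, by positivity,
    fun γ hγ D hD u => ?_⟩
  obtain ⟨hw, hwK⟩ := hK (A + D) ⟨by linarith [hD.1], by linarith [hD.2]⟩ γ hγ u
  have hγ0 : 0 ≤ γ := hγ.1
  have hwγ : weight γ (A + D) u * γ ≤ K * γ := by gcongr
  calc |shift γ (A + D) D u - D / (A + D) * u| +
        |ζ| * |√(D + varShift γ (A + D) D u) - √(A * D / (A + D))|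
      ≤ 2 * (K * γ) * (1 + |u| ^ 3) +
        |ζ| * (2 * (1 + (A + |DU|)) / √(A * DL / (A + |DU|)) * (K * γ) * (1 + |u| ^ 3)) := by
        gcongr
        · exact abs_shift_sub_le hA (hDL.trans_le hD.1) (by positivity) hw
        · exact abs_sqrt_add_varShift_sub_le hA hDL hD hγ0 hw hwγ
    _ = _ := by ring

lemma abs_mul_add_sub_mul_le (ζ a b κ : ℝ) : |ζ * a + κ - ζ * b| ≤ |ζ| * |a - b| + |κ| := by
  rw [show ζ * a + κ - ζ * b = ζ * (a - b) + κ by ring, ← abs_mul]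
  exact abs_add_le _ _

end Endpoints

section CoverDev

/-- The indicator of `coverSet`, centred at the nominal level. -/
def coverDev (α γ : ℝ) (ψ : Param p) (κ : ℝ) (t : Area p) : ℝ :=
  (coverSet α γ ψ κ).indicator 1 t - (1 - α)

variable {α : ℝ} (γ : ℝ) (ψ : Param p) (κ : ℝ)

lemma measurable_coverDev (α : ℝ) : Measurable (coverDev α γ ψ κ) :=
  (measurable_one.indicator (measurableSet_coverSet γ ψ α κ)).sub_const _

lemma abs_coverDev_le (hα : α ∈ Ioo (0 : ℝ) 1) (t : Area p) : |coverDev α γ ψ κ t| ≤ 1 := by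
  obtain ⟨hα0, hα1⟩ := hα
  unfold coverDev
  by_cases ht : t ∈ coverSet α γ ψ κ
  · rw [indicator_of_mem ht, Pi.one_apply, abs_le]
    constructor <;> linarith
  · rw [indicator_of_notMem ht, abs_le]
    constructor <;> linarith

lemma integral_coverDev_comp (α : ℝ) {X : Type*} [MeasurableSpace X] (μ : Measure X)
    [IsProbabilityMeasure μ] {f : X → Area p} (hf : Measurable f) :
    ∫ x, coverDev α γ ψ κ (f x) ∂μ = μ.real (f ⁻¹' coverSet α γ ψ κ) - (1 - α) := by
  have hm : MeasurableSet (f ⁻¹' coverSet α γ ψ κ) := hf (measurableSet_coverSet γ ψ α κ)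
  have hint : Integrable ((f ⁻¹' coverSet α γ ψ κ).indicator (1 : X → ℝ)) μ :=
    (integrable_const 1).indicator hm
  change ∫ x, ((f ⁻¹' coverSet α γ ψ κ).indicator 1 x - (1 - α)) ∂μ = _
  rw [integral_sub hint (integrable_const _), integral_indicator_one hm, integral_const,
    probReal_univ, one_smul]

end CoverDev

section Clean

variable {A : ℝ} (hA : 0 < A) {α : ℝ} (hα : α ∈ Ioo (0 : ℝ) 1)

include hA hα

/-- Given `(x, D, y)` the clean `θ` has the Bayes posterior, whose interval has exact coverage. -/
lemma abs_integral_coverDev_posterior_le {γ : ℝ} (hγ : 0 ≤ γ) (β x : Cov p) {D : ℝ} (hD : 0 < D)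
    (κ y : ℝ) :
    |∫ θ, coverDev α γ (β, A) κ (((x, D), θ), y)
      ∂(gaussianReal (y - D / (A + D) * (y - lin x β)) (A * D / (A + D)).toNNReal)| ≤
      4 * (|shift γ (A + D) D (y - lin x β) - D / (A + D) * (y - lin x β)| +
        (|zUpper (α / 2)| *
          |√(D + varShift γ (A + D) D (y - lin x β)) - √(A * D / (A + D))| + |κ|)) /
        √(2 * Real.pi * (A * D / (A + D))) := by
  have hs : 0 < A + D := by positivity
  have hv : 0 < A * D / (A + D) := by positivity
  have hv' : (A * D / (A + D)).toNNReal ≠ 0 := (Real.toNNReal_pos.2 hv).ne'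
  have hθ := thetaTilde_eq (ψ := (β, A)) (x := x) (y := y) hγ hs
  have hs2 := sTildeSq_eq (ψ := (β, A)) (x := x) (y := y) hγ hs
  dsimp only at hθ hs2
  rw [integral_coverDev_comp γ (β, A) κ α _ (by fun_prop),
    ← gaussianReal_real_interval hα hv' (y - D / (A + D) * (y - lin x β))]
  refine (abs_gaussianReal_real_interval_sub_le hv' _ (thetaTilde γ (β, A) x D y)
    (zUpper (α / 2) * √(sTildeSq γ (β, A) x D y) + κ) _ _).trans ?_
  rw [Real.coe_toNNReal _ hv.le, hθ, hs2, sub_sub_sub_cancel_left, abs_sub_comm (D / (A + D) * _)]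
  gcongr
  exact abs_mul_add_sub_mul_le _ _ _ _

lemma exists_abs_condMean_coverDev_clean_le {DL : ℝ} (hDL : 0 < DL) (DU : ℝ) :
    ∃ K > 0, ∀ γ ∈ Icc (0 : ℝ) 1, ∀ (β : Cov p) (z : Cov p × ℝ), z.2 ∈ Icc DL DU →
      ∀ ε κ, |κ| ≤ ε →
      |condMean (coverDev α γ (β, A) κ) (gaussianReal (lin z.1 β) A.toNNReal) z| ≤
        K * (γ + ε) := by
  obtain ⟨K, hK0, hK⟩ := exists_endpoint_bound hDL DU hA (zUpper (α / 2))
  set q : ℝ := 4 / √(2 * Real.pi * (A * DL / (A + |DU|)))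
  set M : ℝ := 1 + √(A + |DU|) ^ 3 * ∫ y, |y| ^ 3 ∂(gaussianReal 0 1)
  have : 0 < M := by positivity
  refine ⟨q * (K * M + 1), by positivity, fun γ hγ β ⟨x, D⟩ hD ε κ hκ => ?_⟩
  dsimp only at hD ⊢
  have hε : 0 ≤ ε := (abs_nonneg κ).trans hκ
  have hγ0 : 0 ≤ γ := hγ.1
  have hD0 : 0 < D := hDL.trans_le hD.1
  have hv : A * DL / (A + |DU|) ≤ A * D / (A + D) := mul_div_add_le_mul_div_add hA hDL hD
  set μ : ℝ := lin x β
  have hpost (y : ℝ) : |∫ θ, coverDev α γ (β, A) κ (((x, D), θ), y)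
      ∂(gaussianReal (y - D / (A + D) * (y - μ)) (A * D / (A + D)).toNNReal)| ≤
      q * K * γ * (1 + |y - μ| ^ 3) + q * ε := by
    refine (abs_integral_coverDev_posterior_le hA hα hγ0 β x hD0 κ y).trans ?_
    rw [← add_assoc]
    calc _ ≤ 4 * (K * γ * (1 + |y - μ| ^ 3) + ε) / √(2 * Real.pi * (A * DL / (A + |DU|))) := by
          gcongr
          exact hK γ hγ D hD (y - μ)
      _ = q * K * γ * (1 + |y - μ| ^ 3) + q * ε := by ring
  have hcube : Integrable (fun y => 1 + |y - μ| ^ 3) (gaussianReal μ (A + D).toNNReal) :=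
    (integrable_const _).add (integrable_abs_sub_pow_gaussianReal _ _ 3)
  have hmoment : ∫ y, (1 + |y - μ| ^ 3) ∂(gaussianReal μ (A + D).toNNReal) ≤ M := by
    rw [integral_add (integrable_const _) (integrable_abs_sub_pow_gaussianReal _ _ 3),
      integral_const, probReal_univ, one_smul]
    exact add_le_add_right (integral_abs_sub_pow_gaussianReal_le (by positivity)
      (by linarith [hD.2, le_abs_self DU]) μ 3) 1
  rw [condMean, integral_integral_gaussianReal_swap hA hD0 μ
    (f := fun θ y => coverDev α γ (β, A) κ (((x, D), θ), y))
    ((measurable_coverDev _ _ _ _).comp (by fun_prop)) fun θ y => abs_coverDev_le _ _ _ hα _]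
  calc _ ≤ ∫ y, (q * K * γ * (1 + |y - μ| ^ 3) + q * ε) ∂(gaussianReal μ (A + D).toNNReal) :=
        abs_integral_le_integral_of_abs_le ((hcube.const_mul _).add (integrable_const _)) hpost
    _ ≤ q * K * γ * M + q * ε := by
        rw [integral_add (hcube.const_mul _) (integrable_const _), integral_const_mul,
          integral_const, probReal_univ, one_smul]
        gcongr
    _ ≤ q * K * γ * M + q * ε + (q * γ + q * (K * M) * ε) :=
        le_add_of_nonneg_right (by positivity)
    _ = q * (K * M + 1) * (γ + ε) := by ring

end Clean

section Contaminated

variable {𝒳 : Set (Cov p)} (h𝒳 : Bornology.IsBounded 𝒳) {DL : ℝ} (hDL : 0 < DL) (DU : ℝ)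
  (β : Cov p) {A : ℝ} (hA : 0 < A) {γlo : ℝ} (hγlo : 0 < γlo) (γhi : ℝ)

include h𝒳 hDL hA hγlo

lemma exists_interval_near_direct (ζ : ℝ) {ε : ℝ} (hε : 0 < ε) :
    ∃ R, ∀ γ ∈ Icc γlo γhi, ∀ x ∈ 𝒳, ∀ D ∈ Icc DL DU, ∀ κ, |κ| ≤ ε → ∀ y, R < |y| →
      |thetaTilde γ (β, A) x D y - y| +
        |ζ * √(sTildeSq γ (β, A) x D y) + κ - ζ * √D| ≤ 2 * ε := by
  obtain ⟨L, hL⟩ := h𝒳.exists_norm_le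
  set η : ℝ := ε / (1 + |ζ| / √DL)
  have hη : 0 < η := by positivity
  have hηε : η + |ζ| * (η / √DL) = ε := by
    have hden : 1 + |ζ| / √DL ≠ 0 := by positivity
    calc η + |ζ| * (η / √DL) = η * (1 + |ζ| / √DL) := by ring
      _ = ε := div_mul_cancel₀ _ hden
  have hs2 : 0 < A + |DU| := by positivity
  obtain ⟨R₁, hR₁⟩ := exists_abs_shift_le_of_lt_abs (DU := DU) (γhi := γhi) hDL hs2 hγlo hη
  obtain ⟨R₂, hR₂⟩ := exists_abs_varShift_le_of_lt_abs (DU := DU) (γhi := γhi) hDL hs2 hγlo hη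
  refine ⟨max R₁ R₂ + L * ‖β‖, fun γ hγ x hx D hD κ hκ y hy => ?_⟩
  have hD0 : 0 < D := hDL.trans_le hD.1
  have hγ0 : 0 ≤ γ := hγlo.le.trans hγ.1
  have hs : 0 < A + D := by positivity
  have hbox : (A + D, γ, D) ∈ box DL DU (A + |DU|) γlo γhi :=
    ⟨⟨by linarith [hD.1], by linarith [hD.2, le_abs_self DU]⟩, hγ, hD⟩
  have hlin : |lin x β| ≤ L * ‖β‖ :=
    (abs_lin_le x β).trans (mul_le_mul_of_nonneg_right (hL x hx) (norm_nonneg β))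
  have hu : max R₁ R₂ < |y - lin x β| := by linarith [abs_sub_abs_le_abs_sub y (lin x β)]
  have hshift := hR₁ _ _ hbox ((le_max_left _ _).trans_lt hu)
  have hvar := hR₂ _ _ hbox ((le_max_right _ _).trans_lt hu)
  have hsqrt : |√(D + varShift γ (A + D) D (y - lin x β)) - √D| ≤ η / √DL := by
    refine (abs_sqrt_sub_sqrt_le_div hD0).trans ?_
    rw [add_sub_cancel_left]
    gcongr
    exact hD.1
  rw [thetaTilde_eq hγ0 hs, sTildeSq_eq hγ0 hs, sub_sub_cancel_left, abs_neg]
  calc _ ≤ η + (|ζ| * (η / √DL) + ε) :=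
        add_le_add hshift ((abs_mul_add_sub_mul_le _ _ _ _).trans (by gcongr))
    _ = 2 * ε := by linarith

/-- Given `θ`, the limiting interval `y ± z √D` has exact coverage for `y ∼ N(θ, D)`, so only the
`y` in a bounded interval can spoil the coverage. -/
lemma exists_abs_condMean_coverDev_contam_le {α : ℝ} (hα : α ∈ Ioo (0 : ℝ) 1) {ε : ℝ}
    (hε : 0 < ε) :
    ∃ R, ∀ γ ∈ Icc γlo γhi, ∀ δ : Measure ℝ, IsProbabilityMeasure δ → ∀ z : Cov p × ℝ,
      z.1 ∈ 𝒳 → z.2 ∈ Icc DL DU → ∀ κ, |κ| ≤ ε →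
      |condMean (coverDev α γ (β, A) κ) δ z| ≤
        contamMass δ z.2 R + 8 / √(2 * Real.pi * DL) * ε := by
  obtain ⟨R, hR⟩ :=
    exists_interval_near_direct h𝒳 hDL DU β hA hγlo γhi (zUpper (α / 2)) hε
  refine ⟨R, fun γ hγ δ _ ⟨x, D⟩ hx hD κ hκ => ?_⟩
  dsimp only at hx hD ⊢
  have hD0 : 0 < D := hDL.trans_le hD.1
  have hDnn : D.toNNReal ≠ 0 := (Real.toNNReal_pos.2 hD0).ne'
  have hcond (θ : ℝ) : |∫ y, coverDev α γ (β, A) κ (((x, D), θ), y)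
      ∂(gaussianReal θ D.toNNReal)| ≤
      (gaussianReal θ D.toNNReal).real (Icc (-R) R) + 8 / √(2 * Real.pi * DL) * ε := by
    rw [integral_coverDev_comp γ (β, A) κ α _ (by fun_prop),
      ← gaussianReal_real_interval hα hDnn θ, Real.coe_toNNReal _ hD0.le]
    calc _ ≤ (gaussianReal θ D.toNNReal).real
          (Icc (-R) R ∪ {y | |(|y - θ| - zUpper (α / 2) * √D)| ≤ 2 * ε}) := by
          refine abs_measureReal_sub_le fun y hy => ?_
          rw [mem_union, not_or, mem_Icc, ← abs_le, not_le, mem_ofPred, abs_sub_comm y] at hy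
          rw [mem_ofPred, abs_sub_comm y]
          exact abs_sub_lt_iff_of_notMem_band (hR γ hγ x hx D hD κ hκ y hy.1) hy.2
      _ ≤ (gaussianReal θ D.toNNReal).real (Icc (-R) R) +
            4 * (2 * ε) / √(2 * Real.pi * D.toNNReal) :=
          (measureReal_union_le _ _).trans
            (add_le_add le_rfl (gaussianReal_real_band_le hDnn θ θ _ (by positivity)))
      _ ≤ (gaussianReal θ D.toNNReal).real (Icc (-R) R) + 4 * (2 * ε) / √(2 * Real.pi * DL) := by
          rw [Real.coe_toNNReal _ hD0.le]
          gcongr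
          exact hD.1
      _ = _ := by ring
  simpa only [one_mul] using abs_condMean_le_mul_contamMass_add (W := 1) δ
    fun θ => (hcond θ).trans_eq (by rw [one_mul])

end Contaminated

lemma exists_abs_measureReal_coverSet_sub_le {DL : ℝ} (hDL : 0 < DL) (DU : ℝ) (β : Cov p) {A : ℝ}
    (hA : 0 < A) {α : ℝ} (hα : α ∈ Ioo (0 : ℝ) 1) :
    ∃ K > 0, ∀ 𝒳 : Set (Cov p), Bornology.IsBounded 𝒳 →
      ∀ ν : Measure (Cov p × ℝ), IsProbabilityMeasure ν →
      (∀ᵐ z ∂ν, z.1 ∈ 𝒳 ∧ z.2 ∈ Icc DL DU) → ∀ γlo > 0, ∀ ε > 0, ∃ c > 0, ∀ γ ∈ Icc γlo 1,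
      ∀ ω ∈ Icc (0 : ℝ) 1, ∀ δ : Measure ℝ, IsProbabilityMeasure δ → ∀ κ, |κ| ≤ ε →
      |(areaLaw ν β A ω δ).real (coverSet α γ (β, A) κ) - (1 - α)| ≤
        K * (γ + ε) + ω * rho 𝒳 DL DU β A γ δ / c := by
  obtain ⟨K, hK0, hK⟩ := exists_abs_condMean_coverDev_clean_le (p := p) hA hα hDL DU
  set q : ℝ := 8 / √(2 * Real.pi * DL)
  refine ⟨K + q, by positivity, fun 𝒳 h𝒳 ν _ hν γlo hγlo ε hε => ?_⟩
  obtain ⟨R, hR⟩ := exists_abs_condMean_coverDev_contam_le h𝒳 hDL DU β hA hγlo 1 hα hε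
  obtain ⟨c, hc0, hc⟩ := exists_contamMass_le_rho_div hDL β hA h𝒳 DU R
  refine ⟨c, hc0, fun γ hγ ω hω δ _ κ hκ => ?_⟩
  have hγ0 : 0 ≤ γ := hγlo.le.trans hγ.1
  have hprob := isProbabilityMeasure_areaLaw ν β A hω δ
  have hclean : ∀ᵐ z ∂ν, |condMean (coverDev α γ (β, A) κ)
      (gaussianReal (lin z.1 β) A.toNNReal) z| ≤ K * (γ + ε) :=
    hν.mono fun z hz => hK γ ⟨hγ0, hγ.2⟩ β z hz.2 ε κ hκ
  have hcontam : ∀ᵐ z ∂ν, ω * |condMean (coverDev α γ (β, A) κ) δ z| ≤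
      ω * rho 𝒳 DL DU β A γ δ / c + q * ε := by
    filter_upwards [hν] with z hz
    have hmass := hc γ ⟨hγ0, hγ.2⟩ δ ‹_› z.1 hz.1 z.2 hz.2
    calc ω * |condMean (coverDev α γ (β, A) κ) δ z|
        ≤ ω * (rho 𝒳 DL DU β A γ δ / c + q * ε) :=
          mul_le_mul_of_nonneg_left
            ((hR γ hγ δ ‹_› z hz.1 hz.2 κ hκ).trans (add_le_add_left hmass _)) hω.1
      _ = ω * rho 𝒳 DL DU β A γ δ / c + ω * (q * ε) := by ring
      _ ≤ ω * rho 𝒳 DL DU β A γ δ / c + q * ε :=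
          add_le_add le_rfl (mul_le_of_le_one_left (by positivity) hω.2)
  have h := abs_integral_areaLaw_le ν β A hω δ (measurable_coverDev γ (β, A) κ α)
    (abs_coverDev_le γ (β, A) κ hα) hclean hcontam
  rw [integral_coverDev_comp γ (β, A) κ α _ (f := fun t => t) measurable_id] at h
  refine h.trans ?_
  have hq : 0 ≤ q * γ := by positivity
  linarith

/-! ### Consistency of the estimator -/

lemma dist_residual_prodMk_le {x : Cov p} {L : ℝ} (hx : ‖x‖ ≤ L) (ψ ψ' : Param p) (γ D y : ℝ) :
    dist (y - lin x ψ.1, ψ.2 + D, γ, D) (y - lin x ψ'.1, ψ'.2 + D, γ, D) ≤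
      (L + 1) * dist ψ ψ' := by
  have hL : 0 ≤ L := (norm_nonneg x).trans hx
  have hfst : ‖ψ.1 - ψ'.1‖ ≤ dist ψ ψ' := (dist_eq_norm ψ.1 ψ'.1).ge.trans (le_max_left _ _)
  have hlin : dist (lin x ψ.1) (lin x ψ'.1) ≤ L * dist ψ ψ' :=
    (abs_lin_sub_le x ψ.1 ψ'.1).trans (mul_le_mul hx hfst (norm_nonneg _) hL)
  have hvar : dist ψ.2 ψ'.2 ≤ dist ψ ψ' := le_max_right _ _
  have hLdist : 0 ≤ L * dist ψ ψ' := by positivity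
  simp only [Prod.dist_eq (α := ℝ), dist_sub_left, dist_add_right, dist_self]
  exact max_le (by linarith [dist_nonneg (x := ψ) (y := ψ')])
    (max_le (by linarith) (max_le (by positivity) (by positivity)))

lemma exists_forall_dist_lt_dist_residual_le {Ψ : Set (Param p)} {𝒳 : Set (Cov p)}
    (h𝒳 : Bornology.IsBounded 𝒳) {DL DU s2 γlo γhi : ℝ}
    (hs2 : ∀ ψ ∈ Ψ, ∀ D ∈ Icc DL DU, ψ.2 + D ∈ Icc DL s2) {F : ℝ × ℝ × ℝ × ℝ → ℝ}
    (hF : UniformContinuousOn F (univ ×ˢ box DL DU s2 γlo γhi)) {ε : ℝ} (hε : 0 < ε) :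
    ∃ r > 0, ∀ γ ∈ Icc γlo γhi, ∀ ψ ∈ Ψ, ∀ ψ' ∈ Ψ, dist ψ ψ' < r → ∀ x ∈ 𝒳, ∀ D ∈ Icc DL DU,
      ∀ y, dist (F (y - lin x ψ.1, ψ.2 + D, γ, D)) (F (y - lin x ψ'.1, ψ'.2 + D, γ, D)) ≤ ε := by
  obtain ⟨L, hL⟩ := h𝒳.exists_norm_le
  obtain ⟨r, hr, hFr⟩ := Metric.uniformContinuousOn_iff_le.1 hF ε hε
  refine ⟨r / (|L| + 1), by positivity, fun γ hγ ψ hψ ψ' hψ' hdist x hx D hD y => ?_⟩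
  exact hFr _ ⟨mem_univ _, hs2 ψ hψ D hD, hγ, hD⟩ _ ⟨mem_univ _, hs2 ψ' hψ' D hD, hγ, hD⟩
    ((dist_residual_prodMk_le ((hL x hx).trans (le_abs_self L)) ψ ψ' γ D y).trans
      ((lt_div_iff₀' (by positivity)).1 hdist).le)

section UniformBounds

variable {Ψ : Set (Param p)} (hΨ : IsCompact Ψ) (hpos : ∀ ψ ∈ Ψ, 0 < ψ.2)

include hΨ hpos

lemma exists_add_mem_Icc (DL DU : ℝ) :
    ∃ s2 > 0, ∀ ψ ∈ Ψ, ∀ D ∈ Icc DL DU, ψ.2 + D ∈ Icc DL s2 := by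
  obtain ⟨B, hB⟩ := hΨ.isBounded.exists_norm_le
  refine ⟨|B| + |DU| + 1, by positivity, fun ψ hψ D hD => ⟨?_, ?_⟩⟩
  · linarith [hpos ψ hψ, hD.1]
  · linarith [(le_abs_self ψ.2).trans ((norm_snd_le ψ).trans (hB ψ hψ)), le_abs_self B,
      le_abs_self DU, hD.2]

variable {DL : ℝ} (hDL : 0 < DL) (DU : ℝ)

include hDL

lemma exists_wGamma_mem_Ioc : ∃ W > 0, ∀ γ ∈ Icc (0 : ℝ) 1, ∀ ψ ∈ Ψ, ∀ x, ∀ D ∈ Icc DL DU, ∀ y,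
    wGamma γ ψ x D y ∈ Ioc 0 W := by
  obtain ⟨s2, -, hs2⟩ := exists_add_mem_Icc hΨ hpos DL DU
  obtain ⟨W, hW0, hW⟩ := exists_abs_weight_sub_one_le hDL s2
  refine ⟨W, hW0, fun γ hγ ψ hψ x D hD y => ?_⟩
  have hs : 0 < ψ.2 + D := hDL.trans_le (hs2 ψ hψ D hD).1
  rw [wGamma_eq hγ.1 hs]
  exact ⟨weight_pos hs, (hW _ (hs2 ψ hψ D hD) γ hγ _).2⟩

variable {𝒳 : Set (Cov p)} (h𝒳 : Bornology.IsBounded 𝒳) {γlo : ℝ} (hγlo : 0 < γlo) (γhi : ℝ)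
  {ε : ℝ} (hε : 0 < ε)

include h𝒳 hγlo hε

lemma exists_wGamma_le_of_lt_abs : ∃ R, ∀ γ ∈ Icc γlo γhi, ∀ ψ ∈ Ψ, ∀ x ∈ 𝒳, ∀ D ∈ Icc DL DU,
    ∀ y, R < |y| → wGamma γ ψ x D y ≤ ε := by
  obtain ⟨s2, hs20, hs2⟩ := exists_add_mem_Icc hΨ hpos DL DU
  obtain ⟨L, hL⟩ := h𝒳.exists_norm_le
  obtain ⟨B, hB⟩ := hΨ.isBounded.exists_norm_le
  obtain ⟨R, hR⟩ := exists_weight_le_of_lt_abs (DU := DU) (γhi := γhi) hDL hs20 hγlo hε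
  refine ⟨R + L * B, fun γ hγ ψ hψ x hx D hD y hy => ?_⟩
  rw [wGamma_eq (hγlo.le.trans hγ.1) (hDL.trans_le (hs2 ψ hψ D hD).1)]
  refine hR _ (ψ.2 + D, γ, D) ⟨hs2 ψ hψ D hD, hγ, hD⟩ ?_
  have hlin : |lin x ψ.1| ≤ L * B :=
    (abs_lin_le x ψ.1).trans (mul_le_mul (hL x hx) ((norm_fst_le ψ).trans (hB ψ hψ))
      (norm_nonneg _) ((norm_nonneg x).trans (hL x hx)))
  linarith [abs_sub_abs_le_abs_sub y (lin x ψ.1)]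

lemma exists_forall_dist_lt_abs_sub_le : ∃ r > 0, ∀ γ ∈ Icc γlo γhi, ∀ ψ ∈ Ψ, ∀ ψ' ∈ Ψ,
    dist ψ ψ' < r → ∀ x ∈ 𝒳, ∀ D ∈ Icc DL DU, ∀ y,
      |wGamma γ ψ x D y - wGamma γ ψ' x D y| ≤ ε ∧
      |thetaTilde γ ψ x D y - thetaTilde γ ψ' x D y| ≤ ε ∧
      |sTildeSq γ ψ x D y - sTildeSq γ ψ' x D y| ≤ ε := by
  obtain ⟨s2, hs20, hs2⟩ := exists_add_mem_Icc hΨ hpos DL DU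
  obtain ⟨r₀, hr₀, hweight⟩ := exists_forall_dist_lt_dist_residual_le h𝒳 hs2
    (uniformContinuousOn_weight (γhi := γhi) hDL hs20 hγlo) hε
  obtain ⟨r₁, hr₁, hshift⟩ := exists_forall_dist_lt_dist_residual_le h𝒳 hs2
    (uniformContinuousOn_shift (γhi := γhi) hDL hs20 hγlo) hε
  obtain ⟨r₂, hr₂, hvarShift⟩ := exists_forall_dist_lt_dist_residual_le h𝒳 hs2
    (uniformContinuousOn_varShift (γhi := γhi) hDL hs20 hγlo) hε
  refine ⟨min r₀ (min r₁ r₂), by positivity, fun γ hγ ψ hψ ψ' hψ' hdist x hx D hD y => ?_⟩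
  obtain ⟨hdist₀, hdist₁, hdist₂⟩ : dist ψ ψ' < r₀ ∧ dist ψ ψ' < r₁ ∧ dist ψ ψ' < r₂ := by
    simpa only [lt_min_iff] using hdist
  have hγ0 : 0 ≤ γ := hγlo.le.trans hγ.1
  have hs : ∀ ψ ∈ Ψ, 0 < ψ.2 + D := fun ψ hψ => hDL.trans_le (hs2 ψ hψ D hD).1
  rw [wGamma_eq hγ0 (hs ψ hψ), wGamma_eq hγ0 (hs ψ' hψ'), thetaTilde_eq hγ0 (hs ψ hψ),
    thetaTilde_eq hγ0 (hs ψ' hψ'), sTildeSq_eq hγ0 (hs ψ hψ), sTildeSq_eq hγ0 (hs ψ' hψ'),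
    ← Real.dist_eq, ← Real.dist_eq, ← Real.dist_eq, dist_sub_left, dist_add_left]
  exact ⟨hweight γ hγ ψ hψ ψ' hψ' hdist₀ x hx D hD y,
    hshift γ hγ ψ hψ ψ' hψ' hdist₁ x hx D hD y, hvarShift γ hγ ψ hψ ψ' hψ' hdist₂ x hx D hD y⟩

end UniformBounds

/-- The loss in conditional mean weight, given `z = (x, D)`, when `ψ` replaces the true parameter
`(β, A)` and there is no contamination. -/
def popGap (β : Cov p) (A γ : ℝ) (ψ : Param p) (z : Cov p × ℝ) : ℝ :=
  popWeight γ (A + z.2) (A + z.2) 0 - popWeight γ (A + z.2) (ψ.2 + z.2) (lin z.1 β - lin z.1 ψ.1)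

/-- The difference of the weights of one area at `ψ` and `ψ'`. It is set to zero off the admissible
variances, which makes it bounded everywhere and not just almost surely. -/
def contrast (DL DU γ : ℝ) (ψ ψ' : Param p) : Area p → ℝ :=
  {t : Area p | t.1.1.2 ∈ Icc DL DU}.indicator
    fun t => wGamma γ ψ t.1.1.1 t.1.1.2 t.2 - wGamma γ ψ' t.1.1.1 t.1.1.2 t.2

section Contrast

variable {DL DU γ : ℝ} {ψ ψ' : Param p}

lemma measurable_contrast (DL DU γ : ℝ) (ψ ψ' : Param p) : Measurable (contrast DL DU γ ψ ψ') :=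
  ((measurable_wGamma γ ψ).sub (measurable_wGamma γ ψ')).indicator
    (measurableSet_Icc.preimage (measurable_snd.comp (measurable_fst.comp measurable_fst)))

lemma contrast_eq {x : Cov p} {D : ℝ} (hD : D ∈ Icc DL DU) (θ y : ℝ) :
    contrast DL DU γ ψ ψ' (((x, D), θ), y) = wGamma γ ψ x D y - wGamma γ ψ' x D y :=
  indicator_of_mem (s := {t : Area p | t.1.1.2 ∈ Icc DL DU}) hD _

lemma abs_contrast_le {W : ℝ} (hW : 0 ≤ W)
    (hψ : ∀ x, ∀ D ∈ Icc DL DU, ∀ y, wGamma γ ψ x D y ∈ Ioc 0 W)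
    (hψ' : ∀ x, ∀ D ∈ Icc DL DU, ∀ y, wGamma γ ψ' x D y ∈ Ioc 0 W) (t : Area p) :
    |contrast DL DU γ ψ ψ' t| ≤ W := by
  obtain ⟨⟨⟨x, D⟩, θ⟩, y⟩ := t
  by_cases hD : D ∈ Icc DL DU
  · rw [contrast_eq hD]
    exact abs_sub_le_of_nonneg_of_le (hψ x D hD y).1.le (hψ x D hD y).2 (hψ' x D hD y).1.le
      (hψ' x D hD y).2
  · rw [contrast, indicator_of_notMem (s := {t : Area p | t.1.1.2 ∈ Icc DL DU}) hD, abs_zero]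
    exact hW

lemma condMean_contrast_gaussianReal (hDL : 0 < DL) (hγ : 0 < γ) (hψ : 0 < ψ.2) {β : Cov p} {A : ℝ}
    (hA : 0 < A) {W : ℝ} (hW : ∀ t, |contrast DL DU γ ψ (β, A) t| ≤ W) {z : Cov p × ℝ}
    (hz : z.2 ∈ Icc DL DU) :
    condMean (contrast DL DU γ ψ (β, A)) (gaussianReal (lin z.1 β) A.toNNReal) z =
      -popGap β A γ ψ z := by
  obtain ⟨x, D⟩ := z
  have hD : 0 < D := hDL.trans_le hz.1
  have hs : 0 < ψ.2 + D := by positivity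
  have hs' : 0 < A + D := by positivity
  have hweight : ∀ θ y, contrast DL DU γ ψ (β, A) (((x, D), θ), y) =
      weight γ (ψ.2 + D) (y - lin x ψ.1) - weight γ (A + D) (y - lin x β) := fun θ y => by
    rw [contrast_eq hz, wGamma_eq hγ.le hs, wGamma_eq hγ.le hs']
  rw [condMean, integral_integral_gaussianReal_swap hA hD (lin x β)
    (f := fun θ y => contrast DL DU γ ψ (β, A) (((x, D), θ), y))
    ((measurable_contrast _ _ _ _ _).comp (by fun_prop)) fun _ _ => hW _]
  simp only [hweight, integral_const, probReal_univ, one_smul]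
  rw [integral_sub (integrable_weight_sub hγ.le hs _ _) (integrable_weight_sub hγ.le hs' _ _),
    integral_weight_gaussianReal hγ hs hs', integral_weight_gaussianReal hγ hs' hs', popGap,
    sub_self, neg_sub]

lemma abs_integral_le_mul_measureReal_Icc_add {τ : Measure ℝ} [IsProbabilityMeasure τ] {f : ℝ → ℝ}
    {W R ε : ℝ} (hW : ∀ y, |f y| ≤ W) (hε : 0 ≤ ε) (hfar : ∀ y, R < |y| → |f y| ≤ ε) :
    |∫ y, f y ∂τ| ≤ W * τ.real (Icc (-R) R) + ε := by
  have hint : Integrable ((Icc (-R) R).indicator (1 : ℝ → ℝ)) τ :=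
    (integrable_const (1 : ℝ)).indicator measurableSet_Icc
  have hbound : ∀ y, |f y| ≤ W * (Icc (-R) R).indicator (1 : ℝ → ℝ) y + ε := by
    intro y
    by_cases hy : y ∈ Icc (-R) R
    · simpa [indicator_of_mem hy] using (hW y).trans (le_add_of_nonneg_right hε)
    · rw [indicator_of_notMem hy, mul_zero, zero_add]
      exact hfar y (not_le.1 fun h => hy (abs_le.1 h))
  refine (abs_integral_le_integral_of_abs_le ((hint.const_mul W).add (integrable_const ε))
    hbound).trans_eq ?_
  simp only [Pi.add_apply]
  rw [integral_add (hint.const_mul W) (integrable_const ε), integral_const_mul,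
    integral_indicator_one measurableSet_Icc, integral_const, probReal_univ, one_smul]

end Contrast

section PopGap

variable {Ψ : Set (Param p)} (hΨ : IsCompact Ψ) (hpos : ∀ ψ ∈ Ψ, 0 < ψ.2) {DL : ℝ} (hDL : 0 < DL)
  (DU : ℝ) {β : Cov p} {A : ℝ} (hmem : (β, A) ∈ Ψ)

lemma measurable_popGap (β : Cov p) (A γ : ℝ) (ψ : Param p) : Measurable (popGap β A γ ψ) := by
  have hlin : ∀ β : Cov p, Measurable fun z : Cov p × ℝ => lin z.1 β :=
    measurable_lin measurable_fst
  unfold popGap popWeight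
  fun_prop

include hΨ hpos hDL hmem

lemma exists_abs_popGap_le : ∃ W, ∀ γ ∈ Ioc (0 : ℝ) 1, ∀ ψ ∈ Ψ, ∀ z : Cov p × ℝ,
    z.2 ∈ Icc DL DU → |popGap β A γ ψ z| ≤ W := by
  obtain ⟨W, hW, hwGamma⟩ := exists_wGamma_mem_Ioc hΨ hpos hDL DU
  refine ⟨W, fun γ hγ ψ hψ z hz => ?_⟩
  have hbound := abs_contrast_le hW.le (hwGamma γ (Ioc_subset_Icc_self hγ) ψ hψ)
    (hwGamma γ (Ioc_subset_Icc_self hγ) _ hmem)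
  rw [← abs_neg, ← condMean_contrast_gaussianReal hDL hγ.1 (hpos ψ hψ) (hpos _ hmem) hbound hz]
  exact abs_integral_le_of_abs_le fun _ => abs_integral_le_of_abs_le fun _ => hbound _

lemma integrable_popGap {ν : Measure (Cov p × ℝ)} [IsProbabilityMeasure ν]
    (hν : ∀ᵐ z ∂ν, z.2 ∈ Icc DL DU) {γ : ℝ} (hγ : γ ∈ Ioc (0 : ℝ) 1) {ψ : Param p} (hψ : ψ ∈ Ψ) :
    Integrable (popGap β A γ ψ) ν := by
  obtain ⟨W, hW⟩ := exists_abs_popGap_le hΨ hpos hDL DU hmem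
  exact .of_bound (measurable_popGap β A γ ψ).aestronglyMeasurable W
    (hν.mono fun z hz => hW γ hγ ψ hψ z hz)

end PopGap

section MeanContrast

variable {Ψ : Set (Param p)} (hΨ : IsCompact Ψ) (hpos : ∀ ψ ∈ Ψ, 0 < ψ.2) {DL : ℝ} (hDL : 0 < DL)
  {𝒳 : Set (Cov p)} (h𝒳 : Bornology.IsBounded 𝒳) (DU : ℝ) {γlo : ℝ} (hγlo : 0 < γlo)
  {ε : ℝ} (hε : 0 < ε)

include hΨ hpos hDL h𝒳 hγlo hε

-- Far observations get almost no weight at either parameter, whatever produced them.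
lemma exists_abs_condMean_contrast_le : ∃ W > 0, ∃ R, ∀ γ ∈ Icc γlo 1, ∀ ψ ∈ Ψ, ∀ ψ' ∈ Ψ,
    ∀ δ : Measure ℝ, IsProbabilityMeasure δ → ∀ x ∈ 𝒳, ∀ D ∈ Icc DL DU,
      |condMean (contrast DL DU γ ψ ψ') δ (x, D)| ≤ W * contamMass δ D R + ε := by
  obtain ⟨W, hW, hwGamma⟩ := exists_wGamma_mem_Ioc hΨ hpos hDL DU
  obtain ⟨R, hR⟩ := exists_wGamma_le_of_lt_abs hΨ hpos hDL DU h𝒳 hγlo 1 hε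
  refine ⟨W, hW, R, fun γ hγ ψ hψ ψ' hψ' δ _ x hx D hD => ?_⟩
  have hγ01 : γ ∈ Icc (0 : ℝ) 1 := ⟨hγlo.le.trans hγ.1, hγ.2⟩
  refine abs_condMean_le_mul_contamMass_add δ fun θ => abs_integral_le_mul_measureReal_Icc_add
    (fun y => abs_contrast_le hW.le (hwGamma γ hγ01 ψ hψ) (hwGamma γ hγ01 ψ' hψ') _) hε.le
    fun y hy => ?_
  rw [contrast_eq hD]
  exact abs_sub_le_of_nonneg_of_le (hwGamma γ hγ01 ψ hψ x D hD y).1.le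
    (hR γ hγ ψ hψ x hx D hD y hy) (hwGamma γ hγ01 ψ' hψ' x D hD y).1.le
    (hR γ hγ ψ' hψ' x hx D hD y hy)

lemma exists_mul_condMean_contrast_le {β : Cov p} {A : ℝ} (hmem : (β, A) ∈ Ψ) :
    ∃ c > 0, ∀ γ ∈ Icc γlo 1, ∀ ω ∈ Icc (0 : ℝ) 1, ∀ δ : Measure ℝ, IsProbabilityMeasure δ →
      ∀ ψ ∈ Ψ, ∀ x ∈ 𝒳, ∀ D ∈ Icc DL DU, ω * condMean (contrast DL DU γ ψ (β, A)) δ (x, D) ≤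
        ω * rho 𝒳 DL DU β A γ δ / c + ε := by
  obtain ⟨W, hW, R, hR⟩ := exists_abs_condMean_contrast_le hΨ hpos hDL h𝒳 DU hγlo hε
  obtain ⟨c, hc, hmass⟩ := exists_contamMass_le_rho_div hDL β (hpos _ hmem) h𝒳 DU R
  refine ⟨c / W, by positivity, fun γ hγ ω hω δ _ ψ hψ x hx D hD => ?_⟩
  have hγ01 : γ ∈ Icc (0 : ℝ) 1 := ⟨hγlo.le.trans hγ.1, hγ.2⟩
  calc ω * condMean (contrast DL DU γ ψ (β, A)) δ (x, D)
      ≤ ω * (W * (rho 𝒳 DL DU β A γ δ / c) + ε) := by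
        refine mul_le_mul_of_nonneg_left ((le_abs_self _).trans
          ((hR γ hγ ψ hψ _ hmem δ ‹_› x hx D hD).trans ?_)) hω.1
        linarith [mul_le_mul_of_nonneg_left (hmass γ hγ01 δ ‹_› x hx D hD) hW.le]
    _ = ω * rho 𝒳 DL DU β A γ δ / (c / W) + ω * ε := by
        field_simp
    _ ≤ ω * rho 𝒳 DL DU β A γ δ / (c / W) + ε := by
        linarith [mul_le_of_le_one_left hε.le hω.2]

lemma exists_integral_contrast_le {β : Cov p} {A : ℝ} (hmem : (β, A) ∈ Ψ)
    (ν : Measure (Cov p × ℝ)) [IsProbabilityMeasure ν]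
    (hν : ∀ᵐ z ∂ν, z.1 ∈ 𝒳 ∧ z.2 ∈ Icc DL DU) :
    ∃ c > 0, ∀ γ ∈ Icc γlo 1, ∀ ω ∈ Icc (0 : ℝ) 1, ∀ δ : Measure ℝ, IsProbabilityMeasure δ →
      ∀ ψ ∈ Ψ, ∫ t, contrast DL DU γ ψ (β, A) t ∂(areaLaw ν β A ω δ) ≤
        -((1 - ω) * ∫ z, popGap β A γ ψ z ∂ν) + (ω * rho 𝒳 DL DU β A γ δ / c + ε) := by
  obtain ⟨W, hW, hwGamma⟩ := exists_wGamma_mem_Ioc hΨ hpos hDL DU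
  obtain ⟨c, hc, hcontam⟩ := exists_mul_condMean_contrast_le hΨ hpos hDL h𝒳 DU hγlo hε hmem
  refine ⟨c, hc, fun γ hγ ω hω δ _ ψ hψ => ?_⟩
  have hγ0 : 0 < γ := hγlo.trans_le hγ.1
  have hbound := abs_contrast_le hW.le (hwGamma γ ⟨hγ0.le, hγ.2⟩ ψ hψ)
    (hwGamma γ ⟨hγ0.le, hγ.2⟩ _ hmem)
  obtain ⟨hint, heq⟩ := integral_areaLaw ν β A hω δ (measurable_contrast DL DU γ ψ (β, A)) hbound
  set e := ω * rho 𝒳 DL DU β A γ δ / c + ε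
  have hgap : Integrable (fun z => -((1 - ω) * popGap β A γ ψ z)) ν :=
    ((integrable_popGap hΨ hpos hDL DU hmem (hν.mono fun _ hz => hz.2) ⟨hγ0, hγ.2⟩
      hψ).const_mul _).neg
  rw [heq]
  calc _ ≤ ∫ z, (-((1 - ω) * popGap β A γ ψ z) + e) ∂ν := by
        refine integral_mono_ae hint (hgap.add (integrable_const e)) ?_
        filter_upwards [hν] with z hz
        rw [condMean_contrast_gaussianReal hDL hγ0 (hpos ψ hψ) (hpos _ hmem) hbound hz.2, mul_neg]
        exact add_le_add_right (hcontam γ hγ ω hω δ ‹_› ψ hψ z.1 hz.1 z.2 hz.2) _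
    _ = -((1 - ω) * ∫ z, popGap β A γ ψ z ∂ν) + e := by
        rw [integral_add hgap (integrable_const e), integral_neg, integral_const_mul,
          integral_const, probReal_univ, one_smul]

end MeanContrast

lemma continuousOn_popGap (β : Cov p) {A : ℝ} {z : Cov p × ℝ} (hA : 0 < A) (hz : 0 < z.2) :
    ContinuousOn (fun q : ℝ × Param p => popGap β A q.1 q.2 z) (Ioi 0 ×ˢ {ψ | 0 < ψ.2}) := by
  have hpop := continuousOn_popWeight (add_pos hA hz)
  have hlin : Continuous fun q : ℝ × Param p => lin z.1 q.2.1 := by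
    unfold lin
    fun_prop
  exact (hpop.comp (f := fun q : ℝ × Param p => (q.1, A + z.2, 0)) (by fun_prop)
    fun q hq => ⟨hq.1, add_pos hA hz, mem_univ _⟩).sub
    (hpop.comp (f := fun q : ℝ × Param p => (q.1, q.2.2 + z.2, lin z.1 β - lin z.1 q.2.1))
      (by fun_prop) fun q hq => ⟨hq.1, add_pos hq.2 hz, mem_univ _⟩)

section Identifiability

variable {𝒳 : Set (Cov p)} (h𝒳 : Bornology.IsBounded 𝒳) {ν : Measure (Cov p × ℝ)}
  [IsProbabilityMeasure ν]

include h𝒳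

lemma integrable_coord_mul_coord (hν : ∀ᵐ z ∂ν, z.1 ∈ 𝒳) (j k : Fin p) :
    Integrable (fun z : Cov p × ℝ => z.1 j * z.1 k) ν := by
  obtain ⟨L, hL⟩ := h𝒳.exists_norm_le
  refine .of_bound (by fun_prop) (L * L) ?_
  filter_upwards [hν] with z hz
  have hcoord : ∀ j, ‖z.1 j‖ ≤ L := fun j => (PiLp.norm_apply_le z.1 j).trans (hL _ hz)
  rw [norm_mul]
  exact mul_le_mul (hcoord j) (hcoord k) (norm_nonneg _) ((norm_nonneg _).trans (hL _ hz))

lemma eq_zero_of_lin_ae_eq_zero (hν : ∀ᵐ z ∂ν, z.1 ∈ 𝒳) (hM : (secondMoment ν).PosDef) {b : Cov p}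
    (hb : ∀ᵐ z ∂ν, lin z.1 b = 0) : b = 0 := by
  have hmul : Matrix.mulVec (secondMoment ν) b.ofLp = 0 := by
    funext j
    calc ∑ k, (∫ z, z.1 j * z.1 k ∂ν) * b k = ∫ z, ∑ k, z.1 j * z.1 k * b k ∂ν := by
          simp only [← integral_mul_const]
          exact (integral_finsetSum _
            fun k _ => (integrable_coord_mul_coord h𝒳 hν j k).mul_const _).symm
      _ = ∫ z, z.1 j * lin z.1 b ∂ν := by simp only [lin, Finset.mul_sum, mul_assoc]
      _ = 0 := integral_eq_zero_of_ae (hb.mono fun z hz => by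
          simp only [hz, mul_zero, Pi.zero_apply])
  by_contra hne
  have hpos := hM.dotProduct_mulVec_pos (x := b.ofLp) fun h => hne (WithLp.ofLp_injective 2 h)
  rw [hmul, dotProduct_zero] at hpos
  exact lt_irrefl _ hpos

variable {Ψ : Set (Param p)} (hΨ : IsCompact Ψ) (hpos : ∀ ψ ∈ Ψ, 0 < ψ.2) {DL DU : ℝ}
  (hDL : 0 < DL) {β : Cov p} {A : ℝ} (hmem : (β, A) ∈ Ψ)
  (hν : ∀ᵐ z ∂ν, z.1 ∈ 𝒳 ∧ z.2 ∈ Icc DL DU) (hM : (secondMoment ν).PosDef)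

include hΨ hpos hDL hmem hν hM

lemma integral_popGap_pos {γ : ℝ} (hγ : γ ∈ Ioc (0 : ℝ) 1) {ψ : Param p} (hψ : ψ ∈ Ψ)
    (hne : ψ ≠ (β, A)) : 0 < ∫ z, popGap β A γ ψ z ∂ν := by
  have hs : ∀ ψ ∈ Ψ, ∀ z : Cov p × ℝ, z.2 ∈ Icc DL DU → 0 < ψ.2 + z.2 := fun ψ hψ z hz =>
    add_pos (hpos ψ hψ) (hDL.trans_le hz.1)
  have hnonneg : 0 ≤ᵐ[ν] popGap β A γ ψ := hν.mono fun z hz =>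
    sub_nonneg.2 (popWeight_le hγ.1 (hs ψ hψ z hz.2) (hs _ hmem z hz.2))
  refine (integral_nonneg_of_ae hnonneg).lt_of_ne fun hzero => hne ?_
  have hgap := (integral_eq_zero_iff_of_nonneg_ae hnonneg (integrable_popGap hΨ hpos hDL DU hmem
    (hν.mono fun _ hz => hz.2) hγ hψ)).1 hzero.symm
  have hparam : ∀ᵐ z ∂ν, ψ.2 = A ∧ lin z.1 (β - ψ.1) = 0 := by
    filter_upwards [hν, hgap] with z hz hgapz
    obtain ⟨hvar, hlin⟩ := (popWeight_eq_iff hγ.1 (hs ψ hψ z hz.2) (hs _ hmem z hz.2)).1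
      (sub_eq_zero.1 hgapz).symm
    refine ⟨add_right_cancel hvar, ?_⟩
    rwa [lin_eq_inner, inner_sub_left, ← lin_eq_inner, ← lin_eq_inner]
  have hβ := eq_zero_of_lin_ae_eq_zero h𝒳 (hν.mono fun _ hz => hz.1) hM
    (hparam.mono fun _ hz => hz.2)
  obtain ⟨z, hz⟩ := hparam.exists
  exact Prod.ext (sub_eq_zero.1 hβ).symm hz.1

lemma exists_le_integral_popGap {γlo : ℝ} (hγlo : 0 < γlo) {η : ℝ} (hη : 0 < η) :
    ∃ g > 0, ∀ γ ∈ Icc γlo 1, ∀ ψ ∈ Ψ, η ≤ dist ψ (β, A) → g ≤ ∫ z, popGap β A γ ψ z ∂ν := by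
  obtain ⟨W, hW⟩ := exists_abs_popGap_le hΨ hpos hDL DU hmem
  have hγ0 : ∀ γ ∈ Icc γlo 1, γ ∈ Ioc (0 : ℝ) 1 := fun γ hγ => ⟨hγlo.trans_le hγ.1, hγ.2⟩
  have hK : IsCompact (Icc γlo 1 ×ˢ (Ψ \ Metric.ball (β, A) η)) :=
    isCompact_Icc.prod (hΨ.diff Metric.isOpen_ball)
  have hcont : ContinuousOn (fun q : ℝ × Param p => ∫ z, popGap β A q.1 q.2 z ∂ν)
      (Icc γlo 1 ×ˢ (Ψ \ Metric.ball (β, A) η)) := by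
    refine continuousOn_of_dominated (bound := fun _ => W)
      (fun q _ => (measurable_popGap β A q.1 q.2).aestronglyMeasurable)
      (fun q hq => hν.mono fun z hz => hW q.1 (hγ0 _ hq.1) q.2 hq.2.1 z hz.2)
      (integrable_const W) (hν.mono fun z hz => ?_)
    exact (continuousOn_popGap β (hpos _ hmem) (hDL.trans_le hz.2.1)).mono
      fun q hq => ⟨(hγ0 _ hq.1).1, hpos _ hq.2.1⟩
  obtain ⟨g, hg, hmin⟩ := hK.exists_forall_le' hcont fun q hq =>
    integral_popGap_pos h𝒳 hΨ hpos hDL hmem hν hM (hγ0 _ hq.1) hq.2.1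
      (fun h => hq.2.2 (h ▸ Metric.mem_ball_self hη))
  exact ⟨g, hg, fun γ hγ ψ hψ hdist => hmin (γ, ψ) ⟨hγ, hψ, fun hball => hdist.not_gt hball⟩⟩

end Identifiability

section Consistency

lemma IsGammaEstimate.sum_wGamma_le {m : ℕ} {γ : ℝ} (hγ : 0 < γ) {S : Set (Param p)}
    {x : Fin m → Cov p} {D y : Fin m → ℝ} {ψ ψ' : Param p} (hψ : IsGammaEstimate γ S x D y ψ)
    (hψ' : ψ' ∈ S) :
    ∑ i, wGamma γ ψ' (x i) (D i) (y i) ≤ ∑ i, wGamma γ ψ (x i) (D i) (y i) := by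
  have hle := hψ.2 ψ' hψ'
  simp only [gammaLik, ← Finset.mul_sum] at hle
  exact le_of_mul_le_mul_left hle (by positivity)

lemma neg_mul_le_sum_contrast {m : ℕ} {DL DU γ ε : ℝ} (hγ : 0 < γ) {S : Set (Param p)}
    {X : Fin m → Area p} (hX : ∀ i, (X i).1.1.2 ∈ Icc DL DU) {ψ ψ₀ ψ' : Param p}
    (hψ : IsGammaEstimate γ S (fun i => (X i).1.1.1) (fun i => (X i).1.1.2) (fun i => (X i).2) ψ)
    (hψ' : ψ' ∈ S) (hclose : ∀ i, |wGamma γ ψ (X i).1.1.1 (X i).1.1.2 (X i).2 -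
      wGamma γ ψ₀ (X i).1.1.1 (X i).1.1.2 (X i).2| ≤ ε) :
    -(m * ε) ≤ ∑ i, contrast DL DU γ ψ₀ ψ' (X i) := by
  have hterm : ∀ i, wGamma γ ψ (X i).1.1.1 (X i).1.1.2 (X i).2 -
      wGamma γ ψ' (X i).1.1.1 (X i).1.1.2 (X i).2 - ε ≤ contrast DL DU γ ψ₀ ψ' (X i) := fun i => by
    rw [contrast_eq (hX i)]
    linarith [(abs_le.1 (hclose i)).2]
  have hsum := Finset.sum_le_sum fun i (_ : i ∈ Finset.univ) => hterm i
  simp only [Finset.sum_sub_distrib, Finset.sum_const, Finset.card_univ, Fintype.card_fin,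
    nsmul_eq_mul] at hsum
  linarith [hψ.sum_wGamma_le hγ hψ']

variable {𝒳 : Set (Cov p)} (h𝒳 : Bornology.IsBounded 𝒳) {Ψ : Set (Param p)} (hΨ : IsCompact Ψ)
  (hpos : ∀ ψ ∈ Ψ, 0 < ψ.2) {DL : ℝ} (hDL : 0 < DL) {γlo : ℝ} (hγlo : 0 < γlo)

include h𝒳 hΨ hpos hDL hγlo

lemma exists_finset_neg_mul_le_sum_contrast (DU : ℝ) (ψ' : Param p) (η : ℝ) {r : ℝ} (hr : 0 < r) :
    ∃ T : Finset (Param p), (∀ ψ₀ ∈ T, ψ₀ ∈ Ψ ∧ η ≤ dist ψ₀ ψ') ∧ ∀ γ ∈ Icc γlo 1,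
      ∀ (m : ℕ) (X : Fin m → Area p), (∀ i, (X i).1.1.1 ∈ 𝒳 ∧ (X i).1.1.2 ∈ Icc DL DU) →
      ∀ S ⊆ Ψ, ψ' ∈ S → ∀ ψ,
      IsGammaEstimate γ S (fun i => (X i).1.1.1) (fun i => (X i).1.1.2) (fun i => (X i).2) ψ →
      η ≤ dist ψ ψ' → ∃ ψ₀ ∈ T, -(m * r) ≤ ∑ i, contrast DL DU γ ψ₀ ψ' (X i) := by
  obtain ⟨d, hd, hclose⟩ := exists_forall_dist_lt_abs_sub_le hΨ hpos hDL DU h𝒳 hγlo 1 hr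
  obtain ⟨T, hTK, hT, hcover⟩ := Metric.finite_approx_of_totallyBounded
    (hΨ.diff (Metric.isOpen_ball (x := ψ') (ε := η))).totallyBounded d hd
  refine ⟨hT.toFinset, fun ψ₀ hψ₀ => ?_, fun γ hγ m X hX S hSΨ hψ' ψ hψ hfar => ?_⟩
  · have hψ₀K := hTK (hT.mem_toFinset.1 hψ₀)
    exact ⟨hψ₀K.1, not_lt.1 hψ₀K.2⟩
  · obtain ⟨ψ₀, hψ₀, hdist⟩ := mem_iUnion₂.1 (hcover ⟨hSΨ hψ.1, not_lt.2 hfar⟩)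
    exact ⟨ψ₀, hT.mem_toFinset.2 hψ₀, neg_mul_le_sum_contrast (hγlo.trans_le hγ.1)
      (fun i => (hX i).2) hψ hψ' fun i => (hclose γ hγ ψ (hSΨ hψ.1) ψ₀ (hTK hψ₀).1 hdist _ (hX i).1
        _ (hX i).2 _).1⟩

variable {DU : ℝ} {β : Cov p} {A : ℝ} (hmem : (β, A) ∈ Ψ) {ν : Measure (Cov p × ℝ)}
  [IsProbabilityMeasure ν] (hν : ∀ᵐ z ∂ν, z.1 ∈ 𝒳 ∧ z.2 ∈ Icc DL DU)
  (hM : (secondMoment ν).PosDef) {ωhi : ℝ} (hωhi : ωhi < 1) {η : ℝ} (hη : 0 < η)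

include hmem hν hM hωhi hη

lemma exists_integral_contrast_le_neg : ∃ r > 0, ∃ c > 0, ∀ γ ∈ Icc γlo 1, ∀ ω ∈ Icc 0 ωhi,
    ∀ δ : Measure ℝ, IsProbabilityMeasure δ → ω * rho 𝒳 DL DU β A γ δ ≤ c →
    ∀ ψ ∈ Ψ, η ≤ dist ψ (β, A) →
      ∫ t, contrast DL DU γ ψ (β, A) t ∂(areaLaw ν β A ω δ) ≤ -(2 * r) := by
  obtain ⟨g, hg, hgap⟩ := exists_le_integral_popGap h𝒳 hΨ hpos hDL hmem hν hM hγlo hη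
  have hr : 0 < (1 - ωhi) * g / 4 := by
    have := sub_pos.2 hωhi
    positivity
  obtain ⟨c, hc, hmean⟩ := exists_integral_contrast_le hΨ hpos hDL h𝒳 DU hγlo hr hmem ν hν
  refine ⟨(1 - ωhi) * g / 4, hr, c * ((1 - ωhi) * g / 4), by positivity,
    fun γ hγ ω hω δ _ hρ ψ hψ hfar => ?_⟩
  have hloss : (1 - ωhi) * g ≤ (1 - ω) * ∫ z, popGap β A γ ψ z ∂ν :=
    mul_le_mul (by linarith [hω.2]) (hgap γ hγ ψ hψ hfar) hg.le (by linarith [hω.2])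
  have hcontam : ω * rho 𝒳 DL DU β A γ δ / c ≤ (1 - ωhi) * g / 4 := (div_le_iff₀' hc).2 hρ
  linarith [hmean γ hγ ω ⟨hω.1, hω.2.trans hωhi.le⟩ δ ‹_› ψ hψ]

lemma exists_measureReal_le_dist_le_exp : ∃ n : ℕ, ∃ b > 0, ∃ c > 0, ∀ γ ∈ Icc γlo 1,
    ∀ ω ∈ Icc 0 ωhi, ∀ δ : Measure ℝ, IsProbabilityMeasure δ → ω * rho 𝒳 DL DU β A γ δ ≤ c →
    ∀ S ⊆ Ψ, (β, A) ∈ S → ∀ (Ω : Type*) (_ : MeasurableSpace Ω) (P : Measure Ω),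
    IsProbabilityMeasure P → ∀ (m : ℕ) (X : Fin m → Ω → Area p), iIndepFun X P →
    (∀ i, HasLaw (X i) (areaLaw ν β A ω δ) P) → ∀ ψhat : Ω → Param p,
    (∀ᵐ w ∂P, IsGammaEstimate γ S (fun i => (X i w).1.1.1) (fun i => (X i w).1.1.2)
      (fun i => (X i w).2) (ψhat w)) →
    P.real {w | η ≤ dist (ψhat w) (β, A)} ≤ n * Real.exp (-(m * b)) := by
  obtain ⟨r, hr, c, hc, hmean⟩ :=
    exists_integral_contrast_le_neg h𝒳 hΨ hpos hDL hγlo hmem hν hM hωhi hη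
  obtain ⟨T, hTfar, hT⟩ :=
    exists_finset_neg_mul_le_sum_contrast h𝒳 hΨ hpos hDL hγlo DU (β, A) η hr
  obtain ⟨W, hW, hwGamma⟩ := exists_wGamma_mem_Ioc hΨ hpos hDL DU
  refine ⟨T.card, r ^ 2 / (2 * W ^ 2), by positivity, c, hc,
    fun γ hγ ω hω δ _ hρ S hSΨ hS Ω _ P _ m X hind hlaw ψhat hψhat => ?_⟩
  have hγ01 : γ ∈ Icc (0 : ℝ) 1 := ⟨hγlo.le.trans hγ.1, hγ.2⟩
  have hsupp : ∀ᵐ w ∂P, ∀ i, (X i w).1.1.1 ∈ 𝒳 ∧ (X i w).1.1.2 ∈ Icc DL DU :=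
    ae_all_iff.2 fun i => ae_of_ae_map (hlaw i).aemeasurable
      ((hlaw i).map_eq ▸ ae_areaLaw β A ⟨hω.1, hω.2.trans hωhi.le⟩ δ hν)
  have hcover : {w | η ≤ dist (ψhat w) (β, A)} ≤ᵐ[P]
      (⋃ ψ ∈ T, {w | -(m * r) ≤ ∑ i, contrast DL DU γ ψ (β, A) (X i w)} : Set Ω) := by
    filter_upwards [hsupp, hψhat] with w hw hest hfar
    obtain ⟨ψ, hψT, hψ⟩ := hT γ hγ m (fun i => X i w) hw S hSΨ hS _ hest hfar
    exact mem_iUnion₂.2 ⟨ψ, hψT, hψ⟩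
  calc P.real {w | η ≤ dist (ψhat w) (β, A)}
      ≤ P.real (⋃ ψ ∈ T, {w | -(m * r) ≤ ∑ i, contrast DL DU γ ψ (β, A) (X i w)}) :=
        ENNReal.toReal_mono (measure_ne_top _ _) (measure_mono_ae hcover)
    _ ≤ ∑ ψ ∈ T, P.real {w | -(m * r) ≤ ∑ i, contrast DL DU γ ψ (β, A) (X i w)} :=
        measureReal_biUnion_finset_le _ _
    _ ≤ ∑ ψ ∈ T, Real.exp (-(m * (r ^ 2 / (2 * W ^ 2)))) :=
        Finset.sum_le_sum fun ψ hψ => measureReal_sum_ge_le_exp hind hlaw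
          (measurable_contrast _ _ _ _ _) (abs_contrast_le hW.le
            (hwGamma γ hγ01 ψ (hTfar ψ hψ).1) (hwGamma γ hγ01 _ hmem)) hr.le
          (hmean γ hγ ω hω δ ‹_› hρ ψ (hTfar ψ hψ).1 (hTfar ψ hψ).2)
    _ = T.card * Real.exp (-(m * (r ^ 2 / (2 * W ^ 2)))) := by
        rw [Finset.sum_const, nsmul_eq_mul]

end Consistency

/-! ### Coverage of the robust interval -/

lemma mem_robustInterval_iff {α γ : ℝ} {ψ : Param p} {x : Cov p} {D y θ : ℝ} :
    θ ∈ robustInterval α γ ψ x D y ↔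
      |θ - thetaTilde γ ψ x D y| < zUpper (α / 2) * √(sTildeSq γ ψ x D y) := by
  rw [robustInterval, mem_Ioo, abs_lt]
  constructor <;> rintro ⟨hlower, hupper⟩ <;> constructor <;> linarith

lemma exists_robustInterval_sandwich {𝒳 : Set (Cov p)} (h𝒳 : Bornology.IsBounded 𝒳) {DL : ℝ}
    (hDL : 0 < DL) (DU : ℝ) {Ψ : Set (Param p)} (hΨ : IsCompact Ψ) (hpos : ∀ ψ ∈ Ψ, 0 < ψ.2)
    (α : ℝ) {γlo : ℝ} (hγlo : 0 < γlo) (γhi : ℝ) {ψ₀ : Param p} (hψ₀ : ψ₀ ∈ Ψ) {ε : ℝ}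
    (hε : 0 < ε) :
    ∃ η > 0, ∀ γ ∈ Icc γlo γhi, ∀ ψ ∈ Ψ, dist ψ ψ₀ < η → ∀ x ∈ 𝒳, ∀ D ∈ Icc DL DU, ∀ θ y,
      (θ ∈ robustInterval α γ ψ x D y → (((x, D), θ), y) ∈ coverSet α γ ψ₀ ε) ∧
      ((((x, D), θ), y) ∈ coverSet α γ ψ₀ (-ε) → θ ∈ robustInterval α γ ψ x D y) := by
  set z := zUpper (α / 2)
  obtain ⟨κ, hκ, hκε⟩ : ∃ κ > 0, κ + |z| * κ = ε :=
    ⟨ε / (1 + |z|), by positivity, by field_simp⟩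
  obtain ⟨η, hη, hclose⟩ := exists_forall_dist_lt_abs_sub_le hΨ hpos hDL DU h𝒳 hγlo γhi
    (ε := min κ (κ ^ 2)) (by positivity)
  refine ⟨η, hη, fun γ hγ ψ hψ hdist x hx D hD θ y => ?_⟩
  obtain ⟨-, hmean, hvar⟩ := hclose γ hγ ψ hψ ψ₀ hψ₀ hdist x hx D hD y
  have hsqrt : |√(sTildeSq γ ψ x D y) - √(sTildeSq γ ψ₀ x D y)| ≤ κ :=
    (abs_sqrt_sub_sqrt_le_sqrt _ _).trans
      ((Real.sqrt_le_left hκ.le).2 (hvar.trans (min_le_right _ _)))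
  have hradius : |z * √(sTildeSq γ ψ x D y) - z * √(sTildeSq γ ψ₀ x D y)| ≤ |z| * κ := by
    rw [← mul_sub, abs_mul]
    exact mul_le_mul_of_nonneg_left hsqrt (abs_nonneg _)
  have hcenter : |(|θ - thetaTilde γ ψ x D y| - |θ - thetaTilde γ ψ₀ x D y|)| ≤ κ := by
    refine (abs_abs_sub_abs_le_abs_sub _ _).trans ?_
    rw [sub_sub_sub_cancel_left, abs_sub_comm]
    exact hmean.trans (min_le_left _ _)
  rw [abs_le] at hradius hcenter
  rw [mem_robustInterval_iff, coverSet, coverSet, mem_ofPred, mem_ofPred]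
  constructor <;> intro h <;> linarith

lemma abs_measureReal_robustInterval_sub_le {Ω : Type*} [MeasurableSpace Ω] {P : Measure Ω}
    [IsProbabilityMeasure P] {μ : Measure (Area p)} {X : Ω → Area p} (hX : HasLaw X μ P)
    {α γ ε η a b : ℝ} {ψ : Param p} {ψhat : Ω → Param p} (hε : 0 ≤ ε)
    (hcover : ∀ κ, |κ| ≤ ε → |μ.real (coverSet α γ ψ κ) - a| ≤ b)
    (hsandwich : ∀ᵐ w ∂P, dist (ψhat w) ψ < η →
      ((X w).1.2 ∈ robustInterval α γ (ψhat w) (X w).1.1.1 (X w).1.1.2 (X w).2 →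
        X w ∈ coverSet α γ ψ ε) ∧
      (X w ∈ coverSet α γ ψ (-ε) →
        (X w).1.2 ∈ robustInterval α γ (ψhat w) (X w).1.1.1 (X w).1.1.2 (X w).2)) :
    |P.real {w | (X w).1.2 ∈ robustInterval α γ (ψhat w) (X w).1.1.1 (X w).1.1.2 (X w).2} - a| ≤
      b + P.real {w | η ≤ dist (ψhat w) ψ} := by
  have hpreimage (κ : ℝ) (hκ : |κ| ≤ ε) : |P.real (X ⁻¹' coverSet α γ ψ κ) - a| ≤ b := by
    rw [← map_measureReal_apply_of_aemeasurable hX.aemeasurable (measurableSet_coverSet γ ψ α κ),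
      hX.map_eq]
    exact hcover κ hκ
  refine abs_measureReal_sub_le_of_ae_le (L := X ⁻¹' coverSet α γ ψ (-ε))
    (U := X ⁻¹' coverSet α γ ψ ε) ?_ ?_ ?_ ?_
  · filter_upwards [hsandwich] with w hw hmem
    exact (lt_or_ge (dist (ψhat w) ψ) η).imp (fun hnear => (hw hnear).2 hmem) id
  · filter_upwards [hsandwich] with w hw hmem
    exact (lt_or_ge (dist (ψhat w) ψ) η).imp (fun hnear => (hw hnear).1 hmem) id
  · linarith [(abs_le.1 (hpreimage (-ε) (by rw [abs_neg, abs_of_nonneg hε]))).1]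
  · linarith [(abs_le.1 (hpreimage ε (abs_of_nonneg hε).le)).2]

lemma exists_forall_ge_mul_exp_neg_mul_le (n : ℕ) {b ε : ℝ} (hb : 0 < b) (hε : 0 < ε) :
    ∃ N : ℕ, ∀ m ≥ N, n * Real.exp (-(m * b)) ≤ ε := by
  have hlim : Tendsto (fun m : ℕ => n * Real.exp (-(m * b))) atTop (𝓝 (n * 0)) :=
    ((Real.tendsto_exp_neg_atTop_nhds_zero.comp
      (tendsto_natCast_atTop_atTop.atTop_mul_const hb)).const_mul _)
  rw [mul_zero] at hlim
  exact eventually_atTop.1 (hlim.eventually (eventually_le_nhds hε))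

end RobustFH

end

theorem theorem4_general {p : ℕ} {DL : ℝ} (hDL : 0 < DL) (DU : ℝ) (βs : RobustFH.Cov p) {As : ℝ}
    (hAs : 0 < As) {α : ℝ} (hα : α ∈ Ioo (0 : ℝ) 1) :
    ∃ C > 0, ∀ 𝒳 : Set (RobustFH.Cov p), Bornology.IsBounded 𝒳 →
      ∀ ν : Measure (RobustFH.Cov p × ℝ), IsProbabilityMeasure ν →
      (∀ᵐ z ∂ν, z.1 ∈ 𝒳 ∧ z.2 ∈ Icc DL DU) → (RobustFH.secondMoment ν).PosDef →
      ∀ Ψ : Set (RobustFH.Param p), IsCompact Ψ → (∀ ψ ∈ Ψ, 0 < ψ.2) → (βs, As) ∈ Ψ →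
      ∀ γlo > 0, ∀ ωhi < 1, ∃ N : ℕ, ∃ c > 0, ∀ m ≥ N, ∀ γ ∈ Icc γlo 1, ∀ ω ∈ Icc 0 ωhi,
      ∀ δ : Measure ℝ, IsProbabilityMeasure δ → ω * RobustFH.rho 𝒳 DL DU βs As γ δ ≤ c →
      ∀ S ⊆ Ψ, (βs, As) ∈ S → ∀ (Ω : Type*) (_ : MeasurableSpace Ω) (P : Measure Ω),
      IsProbabilityMeasure P → ∀ (x : Fin m → Ω → RobustFH.Cov p) (D θ y : Fin m → Ω → ℝ),
      iIndepFun (fun i w => (((x i w, D i w), θ i w), y i w)) P →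
      (∀ i, HasLaw (fun w => (((x i w, D i w), θ i w), y i w))
        (RobustFH.areaLaw ν βs As ω δ) P) →
      ∀ ψhat : Ω → RobustFH.Param p, (∀ᵐ w ∂P, RobustFH.IsGammaEstimate γ S
        (fun i => x i w) (fun i => D i w) (fun i => y i w) (ψhat w)) →
      ∀ i, |P.real {w | θ i w ∈ RobustFH.robustInterval α γ (ψhat w) (x i w) (D i w) (y i w)} -
        (1 - α)| ≤ C * γ := by
  obtain ⟨K, hK, hcover⟩ := RobustFH.exists_abs_measureReal_coverSet_sub_le hDL DU βs hAs hα
  refine ⟨2 * K + 2, by positivity,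
    fun 𝒳 h𝒳 ν _ hν hM Ψ hΨ hpos hmem γlo hγlo ωhi hωhi => ?_⟩
  -- As `γlo ≤ γ`, the perturbation of the interval, the contamination and the event that the
  -- estimator is far may each cost `γlo`.
  obtain ⟨c₁, hc₁, hcover⟩ := hcover 𝒳 h𝒳 ν ‹_› hν γlo hγlo γlo hγlo
  obtain ⟨η, hη, hsandwich⟩ :=
    RobustFH.exists_robustInterval_sandwich h𝒳 hDL DU hΨ hpos α hγlo 1 hmem hγlo
  obtain ⟨n, b, hb, c₂, hc₂, hfar⟩ :=
    RobustFH.exists_measureReal_le_dist_le_exp h𝒳 hΨ hpos hDL hγlo hmem hν hM hωhi hη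
  obtain ⟨N, hN⟩ := RobustFH.exists_forall_ge_mul_exp_neg_mul_le n hb hγlo
  refine ⟨N, min (c₁ * γlo) c₂, by positivity, fun m hm γ hγ ω hω δ _ hρ S hSΨ hS Ω _ P _
    x D θ y hind hlaw ψhat hest i => ?_⟩
  have hω01 : ω ∈ Icc (0 : ℝ) 1 := ⟨hω.1, hω.2.trans hωhi.le⟩
  have hcontam : ω * RobustFH.rho 𝒳 DL DU βs As γ δ / c₁ ≤ γlo :=
    (div_le_iff₀' hc₁).2 (hρ.trans (min_le_left _ _))
  have hfar := (hfar γ hγ ω hω δ ‹_› (hρ.trans (min_le_right _ _)) S hSΨ hS Ω _ P ‹_› m _ hind hlaw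
    ψhat hest).trans (hN m hm)
  have hsupp := ae_of_ae_map (hlaw i).aemeasurable
    ((hlaw i).map_eq ▸ RobustFH.ae_areaLaw βs As hω01 δ hν)
  have herr := RobustFH.abs_measureReal_robustInterval_sub_le (hlaw i) hγlo.le
    (hcover γ hγ ω hω01 δ ‹_›) (ψhat := ψhat) (η := η) <| by
      filter_upwards [hsupp, hest] with w hw hw' hnear
      exact hsandwich γ hγ _ (hSΨ hw'.1) hnear _ hw.1 _ hw.2 _ _
  have hKγ : K * γlo ≤ K * γ := mul_le_mul_of_nonneg_left hγ.1 hK.le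
  linarith [hγ.1]

theorem theorem4 {p : ℕ} (DL DU : ℝ) (hDL : 0 < DL) (hDLU : DL ≤ DU)
    -- true parameter and nominal level
    (βs : RobustFH.Cov p) (As : ℝ) (hAs : 0 < As)
    (hAD : (2 * Real.pi)⁻¹ * Real.exp (-3) < As + DL)
    (α : ℝ) (hα : α ∈ Ioo (0 : ℝ) 1) :
    -- the constant does not depend on the tuning parameter, nor on `γlo`, `γhi`
    ∃ C : ℝ, 0 < C ∧
      ∀ (𝒳 : Set (RobustFH.Cov p)), Bornology.IsBounded 𝒳 →
      -- law of `(x, D)`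
      ∀ (ν : Measure (RobustFH.Cov p × ℝ)), IsProbabilityMeasure ν →
      (∀ᵐ z ∂ν, z.1 ∈ 𝒳 ∧ z.2 ∈ Icc DL DU) →
      (RobustFH.secondMoment ν).PosDef →
      -- compact parameter space, and the sets over which the objective is maximized
      ∀ (Ψ : Set (RobustFH.Param p)), IsCompact Ψ → (∀ ψ ∈ Ψ, 0 < ψ.2) →
      ∀ (S : ℕ → Set (RobustFH.Param p)), (∀ m, (βs, As) ∈ S m ∧ S m ⊆ Ψ) →
      -- tuning parameter
      ∀ (γlo γhi : ℝ), 0 < γlo → γlo < γhi → γhi < 1 →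
      ∀ (γ : ℕ → ℝ), (∀ m, γ m ∈ Icc γlo γhi) →
      -- contamination ratio and contamination distribution
      ∀ (ω : ℕ → ℝ), (∀ m, ω m ∈ Ico (0 : ℝ) (1 / 2)) →
      ∀ (δ : ℕ → Measure ℝ), (∀ m, IsProbabilityMeasure (δ m)) →
      (∀ m, ∀ D ∈ Icc DL DU, Integrable (fun y => y ^ 2 * RobustFH.margDens (δ m) D y)) →
      ∀ (ζ : ℝ), ζ ∈ Ioo (0 : ℝ) (1 / 2) →
      ((fun m : ℕ => ω m * RobustFH.rho 𝒳 DL DU βs As (γ m) (δ m)) =O[atTop]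
        fun m : ℕ => (m : ℝ) ^ (-ζ)) →
      -- samples: for each `m`, the `m` areas are i.i.d. from the contaminated model
      ∀ (Ω : ℕ → Type*) (_ : ∀ m, MeasurableSpace (Ω m))
        (P : ∀ m, Measure (Ω m)), (∀ m, IsProbabilityMeasure (P m)) →
      ∀ (x : ∀ m, Fin m → Ω m → RobustFH.Cov p) (D θ y : ∀ m, Fin m → Ω m → ℝ),
      (∀ m, iIndepFun (fun i w => (((x m i w, D m i w), θ m i w), y m i w)) (P m)) →
      (∀ m i, HasLaw (fun w => (((x m i w, D m i w), θ m i w), y m i w))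
        (RobustFH.areaLaw ν βs As (ω m) (δ m)) (P m)) →
      -- the robust estimator
      ∀ (ψhat : ∀ m, Ω m → RobustFH.Param p), (∀ m, AEMeasurable (ψhat m) (P m)) →
      (∀ m, ∀ᵐ w ∂(P m), RobustFH.IsGammaEstimate (γ m) (S m)
        (fun i => x m i w) (fun i => D m i w) (fun i => y m i w) (ψhat m w)) →
      ∀ᶠ m in atTop, ∀ i : Fin m,
        |(P m).real {w | θ m i w ∈
            RobustFH.robustInterval α (γ m) (ψhat m w) (x m i w) (D m i w) (y m i w)} - (1 - α)|
          ≤ C * ((ω m * RobustFH.rho 𝒳 DL DU βs As (γ m) (δ m)) ^ (1 / 4 : ℝ) + γ m) := by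
  obtain ⟨C, hC, hcover⟩ := theorem4_general hDL DU βs hAs hα
  refine ⟨C, hC, fun 𝒳 h𝒳 ν _ hν hM Ψ hΨ hpos S hS γlo γhi hγlo _ hγhi γ hγ ω hω δ hδ _ ζ hζ hO
    Ω _ P hP x D θ y hind hlaw ψhat _ hest => ?_⟩
  obtain ⟨N, c, hc, hcover⟩ := hcover 𝒳 h𝒳 ν ‹_› hν hM Ψ hΨ hpos ((hS 0).2 (hS 0).1) γlo hγlo
    (1 / 2) one_half_lt_one
  have hlim : Tendsto (fun m => ω m * RobustFH.rho 𝒳 DL DU βs As (γ m) (δ m)) atTop (𝓝 0) :=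
    hO.trans_tendsto ((tendsto_rpow_neg_atTop hζ.1).comp tendsto_natCast_atTop_atTop)
  filter_upwards [eventually_ge_atTop N, hlim.eventually (eventually_le_nhds hc)] with m hm hρ i
  have hdrop : 0 ≤ (ω m * RobustFH.rho 𝒳 DL DU βs As (γ m) (δ m)) ^ (1 / 4 : ℝ) :=
    Real.rpow_nonneg (mul_nonneg (hω m).1 (RobustFH.rho_nonneg _ _ _ _ _ _ _)) _
  exact (hcover m hm (γ m) ⟨(hγ m).1, (hγ m).2.trans hγhi.le⟩ (ω m) ⟨(hω m).1, (hω m).2.le⟩ (δ m)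
    (hδ m) hρ (S m) (hS m).2 (hS m).1 (Ω m) _ (P m) (hP m) (x m) (D m) (θ m) (y m) (hind m)
    (hlaw m) (ψhat m) (hest m) i).trans
    (mul_le_mul_of_nonneg_left (le_add_of_nonneg_left hdrop) hC.le)
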